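/- Let $(X,\mathscr A)$ be a standard Borel space with a non-atomic probability measure $\mu$. A flow on $(X,\mathscr A,\mu)$ is a family $(T_t)_{t\in\mathbb R}$ of $\mu$-preserving automorphisms with $T_0=\mathrm{Id}$, $T_{s+t}=T_s\circ T_t$ for all $s,t\in\mathbb R$, and $(t,x)\mapsto T_t(x)$ measurable. It is of rank one, with sequences $(s_j)$, $(h_j)$, $(E_j)$, if the $s_j>0$ are real numbers, the $h_j\ge 1$ are integers and the $E_j\in\mathscr A$ are sets such that for every $j$ the sets $E_j,T_{s_j}E_j,\dots,T_{s_j}^{h_j-1}E_j$ are pairwise disjoint; $s_j/s_{j+1}$ is an integer for every $j$; $s_j\to0$ and $s_jh_j\to\infty$; and the partitions $$\xi_j=\Bigl\{E_j,\ T_{s_j}E_j,\ \dots,\ T_{s_j}^{h_j-1}E_j,\ X\setminus\bigsqcup_{i=0}^{h_j-1}T_{s_j}^iE_j\Bigr\}$$ converge to the partition into points, i.e. for every $A\in\mathscr A$ there are sets $A_j$, each a union of elements of $\xi_j$, with $\mu(A\,\triangle\,A_j)\to0$. A factor is a sub-$\sigma$-algebra $\mathscr F\subseteq\mathscr A$ with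 $T_tA\in\mathscr F$ for all $A\in\mathscr F$, $t\in\mathbb R$; it is called non-trivial if it is not all of $\mathscr A$ modulo $\mu$, i.e. if some $A\in\mathscr A$ satisfies $\mu(A\,\triangle\,B)>0$ for every $B\in\mathscr F$. **Theorem (rigidity of factors of rank-one flows).** Let $(T_t)_{t\in\mathbb R}$ be a rank-one flow with sequences $(s_j)$, $(h_j)$, $(E_j)$ as above, and let $\mathscr F$ be a non-trivial factor of it. Then there exists a sequence of integers $(k_j)$ with $|k_js_j|\to\infty$ such that for all $A,B\in\mathscr F$, $$\mu\bigl(A\cap T_{s_j}^{k_j}B\bigr)\longrightarrow\mu(A\cap B)\qquad(j\to\infty).$$ -/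

import Mathlib

open MeasureTheory Filter Topology

/-- A (measurable, measure-preserving) flow on the probability space `(X, μ)`: a jointly measurable
one-parameter group `(T_t)` of automorphisms of `(X, μ)`. Each `T_t` is invertible, with
inverse `T_{-t}`. -/
structure IsFlow {X : Type*} [MeasurableSpace X] (μ : Measure X) (T : ℝ → X → X) : Prop where
  measurable_uncurry : Measurable (fun p : ℝ × X => T p.1 p.2)
  map_zero : ∀ x, T 0 x = x
  map_add : ∀ s t x, T (s + t) x = T s (T t x)
  measurePreserving : ∀ t, MeasurePreserving (T t) μ μ

/-- The `i`-th level `T_s^i E = T_{i s} E` of the tower with base `E` and step `s`. -/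
def towerLevel {X : Type*} (T : ℝ → X → X) (s : ℝ) (E : Set X) (i : ℕ) : Set X :=
  T ((i : ℝ) * s) '' E

/-- The family `{E, T_s E, …, T_s^{h-1} E, X \ ⋃ i < h, T_s^i E}`. -/
def towerPartition {X : Type*} (T : ℝ → X → X) (s : ℝ) (h : ℕ) (E : Set X) : Set (Set X) :=
  {C | ∃ i < h, C = towerLevel T s E i} ∪ {(⋃ i < h, towerLevel T s E i)ᶜ}

/-- A sequence `ξ j` of finite partitions converges to the partition into points (modulo `μ`):
every measurable set `A` is approximated in measure by sets `A' j`, where `A' j` is a union of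
elements of `ξ j`. -/
def ConvergesToPoints {X : Type*} [MeasurableSpace X] (μ : Measure X)
    (ξ : ℕ → Set (Set X)) : Prop :=
  ∀ A, MeasurableSet A → ∃ A' : ℕ → Set X,
    (∀ j, ∃ U ⊆ ξ j, A' j = ⋃₀ U) ∧
    Tendsto (fun j => μ (symmDiff A (A' j))) atTop (𝓝 0)

/-- The sequences of steps `s j`, heights `h j` and bases `E j` witness that the flow `T` is of
rank one. -/
structure IsRankOneData {X : Type*} [MeasurableSpace X] (μ : Measure X) (T : ℝ → X → X)
    (s : ℕ → ℝ) (h : ℕ → ℕ) (E : ℕ → Set X) : Prop where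
  step_pos : ∀ j, 0 < s j
  height_pos : ∀ j, 0 < h j
  measurableSet_base : ∀ j, MeasurableSet (E j)
  disjoint_levels : ∀ j, ∀ i < h j, ∀ l < h j, i ≠ l →
    Disjoint (towerLevel T (s j) (E j) i) (towerLevel T (s j) (E j) l)
  converges : ConvergesToPoints μ (fun j => towerPartition T (s j) (h j) (E j))
  step_ratio : ∀ j, ∃ n : ℤ, s j / s (j + 1) = n
  step_tendsto : Tendsto s atTop (𝓝 0)
  length_tendsto : Tendsto (fun j => s j * (h j : ℝ)) atTop atTop

/-- A factor of the flow `T`: a sub-σ-algebra `F` of the σ-algebra of `X` that is invariant under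
every `T_t`. -/
structure IsFactor {X : Type*} (F : MeasurableSpace X) [mX : MeasurableSpace X]
    (T : ℝ → X → X) : Prop where
  le : F ≤ mX
  invariant : ∀ t A, MeasurableSet[F] A → MeasurableSet[F] (T t '' A)

/-- The σ-algebra `F` is non-trivial as a factor: modulo `μ` it is not the whole σ-algebra, that is,
some measurable set is not almost everywhere equal to any element of `F`. -/
def IsProperModNull {X : Type*} (F : MeasurableSpace X) [mX : MeasurableSpace X]
    (μ : Measure X) : Prop :=
  ∃ A, MeasurableSet A ∧ ∀ B, MeasurableSet[F] B → ¬ (A =ᵐ[μ] B)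

/-!
The proof works with the displacement `∫ |f (T t x) - f x| ∂μ` of a single function `f` with
values in `[0, 1]` which generates the factor (`codingFunction`). If the displacement of `f` can
be made small by arbitrarily long times `t`, then, the flow being continuous in `L¹`
(`tendsto_displacement_zero`), these times may be replaced by multiples of the steps `s j`
(`exists_seq_tendsto_displacement`), and the convergence for the sets of the factor follows.

*A self-joining off the diagonal.* Two points are chosen independently given the factor. Since the
factor is proper, this self-joining is not carried by the diagonal, and it may be conditioned on
the complement of the diagonal. Its marginals are still `μ`, because a rank-one flow has no other
invariant probability measure that is bounded by a multiple of `μ`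
(`measureReal_eq_of_invariant_of_le`). The result is a self-joining `ν` with `x ≠ y` and
`f x = f y` for almost all pairs (`exists_selfJoining_of_isProperModNull`).

*Approximate periods.* In a high tower the function `f` is described by a word
`c 0, …, c (h - 1)`. If two points lie in the levels `i` and `i + k`, they stay in levels with the
difference `k` for as long as they move inside the tower, so that `ν` is there a combination of
diagonals (`IsTowerPosition.setIntegral_selfJoining`). As `f x = f y`, it is carried, up to a
small mass, by those `k` that are approximate periods of the word (`shiftDefect`). Suppose now
that all long times displace `f` by at least `ε`. By subadditivity, all times bounded away from
`0` displace `f` by a definite amount (`exists_pos_le_displacement`). Hence an approximate period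
that is short in comparison with `h` corresponds to a time close to `0`, and such pairs are rare
because `ν` does not charge the diagonal. Most pairs are thus typical (`typicalPairs`): the
difference of their levels is an approximate period comparable with `h`.

*Return to the tower.* Take a typical pair whose second point is just below the top of the tower
and whose first point is therefore well below the second one. After a short while the second point
has left the tower and returned to its bottom, with a gap of `r` steps in between, and the pair is
again typical, the first point now being the upper one. The two differences of levels add up to
`h + r`: this number is a sum of two approximate periods `a` and `A` (`IsAdmissibleGap`,
`IsTowerPosition.mem_gapSet_of_typical`). Since `ν` projects to `μ`, almost all gaps are of this
kind.

*Commutators.* Let `h + r₁ = a + A` and `h + r₂ = b + B` be two such sums. The shifts by `+A`,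
`-b`, `+a`, `-B` can be performed in this order without leaving the word, and their sum is
`r₁ - r₂`. So the words shifted by `r₁` and by `r₂` almost agree (`sum_commutator_le`,
`IsAdmissibleGap.sum_le`). Fix an admissible gap `r₀`. A point of a column with gap `r` is moved
by the time `(h + r₀) * s` from the level `i + r` to the level `i + r₀`, where `f` has about the
same value (`IsTowerPosition.displacement_le_of_gaps`). The long time `(h + r₀) * s` therefore
hardly displaces `f`, which is a contradiction (`exists_displacement_lt`).
-/


/-! ### Approximate periods of words -/

/-- The total variation of a word `c 0, …, c (h - 1)` under the shift by `k`; the letters are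
compared only as long as both positions lie in the word. -/
noncomputable def shiftDefect (c : ℕ → ℝ) (h k : ℕ) : ℝ :=
  ∑ i ∈ Finset.range (h - k), |c i - c (i + k)|

lemma shiftDefect_nonneg (c : ℕ → ℝ) (h k : ℕ) : 0 ≤ shiftDefect c h k :=
  Finset.sum_nonneg fun _ _ => abs_nonneg _

lemma sum_abs_sub_le_shiftDefect (c : ℕ → ℝ) {h k o M : ℕ} (hM : M + o + k ≤ h) :
    ∑ i ∈ Finset.range M, |c (i + o) - c (i + o + k)| ≤ shiftDefect c h k := by
  have h1 : ∑ i ∈ Finset.range M, |c (i + o) - c (i + o + k)|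
      = ∑ i ∈ (Finset.range M).image (· + o), |c i - c (i + k)| := by
    rw [Finset.sum_image (fun a _ b _ hab => by simpa using hab)]
  rw [h1]
  refine Finset.sum_le_sum_of_subset_of_nonneg ?_ fun _ _ _ => abs_nonneg _
  intro i hi
  simp only [Finset.mem_image, Finset.mem_range] at hi ⊢
  omega

/-- Going around a commutator of two approximate rotations: the word has the approximate periods
`a`, `A` with `a + A = h + r₁` and `b`, `B` with `b + B = h + r₂`, so that the path
`+A, -b, +a, -B` leads from `i + r₂` to `i + r₁` within the word. -/
lemma sum_commutator_le (c : ℕ → ℝ) {h a A b B r₁ r₂ M : ℕ} (hA : a + A = h + r₁)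
    (hB : b + B = h + r₂) (hab : a ≤ b) (haB : a ≤ B) (hM : M + r₁ + r₂ ≤ a) :
    ∑ i ∈ Finset.range M, |c (i + r₁) - c (i + r₂)| ≤
      shiftDefect c h A + shiftDefect c h b + shiftDefect c h a + shiftDefect c h B := by
  have h1 := sum_abs_sub_le_shiftDefect c (h := h) (k := A) (o := r₂) (M := M) (by omega)
  have h2 := sum_abs_sub_le_shiftDefect c (h := h) (k := b) (o := r₁ + (B - a)) (M := M) (by omega)
  have h3 := sum_abs_sub_le_shiftDefect c (h := h) (k := a) (o := r₁ + (B - a)) (M := M) (by omega)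
  have h4 := sum_abs_sub_le_shiftDefect c (h := h) (k := B) (o := r₁) (M := M) (by omega)
  refine le_trans ?_ (add_le_add (add_le_add (add_le_add h1 h2) h3) h4)
  simp only [← Finset.sum_add_distrib]
  refine Finset.sum_le_sum fun i _ => ?_
  have e1 : i + (r₁ + (B - a)) + b = i + r₂ + A := by omega
  have e2 : i + (r₁ + (B - a)) + a = i + r₁ + B := by omega
  rw [e1, e2]
  have := abs_sub_le (c (i + r₁)) (c (i + r₁ + B)) (c (i + r₂))
  have := abs_sub_le (c (i + r₁ + B)) (c (i + (r₁ + (B - a)))) (c (i + r₂))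
  have := abs_sub_le (c (i + (r₁ + (B - a)))) (c (i + r₂ + A)) (c (i + r₂))
  have := abs_sub_comm (c (i + r₁ + B)) (c (i + (r₁ + (B - a))))
  have := abs_sub_comm (c (i + r₂ + A)) (c (i + r₂))
  linarith

/-- The estimate of `sum_commutator_le` on an initial block of length `a` is propagated to the whole
word by the approximate period `a`. -/
lemma sum_shift_le_of_periods (c : ℕ → ℝ) (hc : ∀ i j, |c i - c j| ≤ 1) {h a A b B r₁ r₂ : ℕ}
    {θ : ℝ} (hA : a + A = h + r₁) (hB : b + B = h + r₂) (hab : a ≤ b) (haB : a ≤ B)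
    (da : shiftDefect c h a ≤ θ) (dA : shiftDefect c h A ≤ θ) (db : shiftDefect c h b ≤ θ)
    (dB : shiftDefect c h B ≤ θ) (n : ℕ) :
    ∀ M : ℕ, M ≤ n * a → M + r₁ ≤ h → M + r₂ ≤ h →
      ∑ i ∈ Finset.range M, |c (i + r₁) - c (i + r₂)| ≤ n * (6 * θ + (r₁ + r₂)) := by
  have hθ : 0 ≤ θ := (shiftDefect_nonneg c h a).trans da
  have base : ∀ M ≤ a, ∑ i ∈ Finset.range M, |c (i + r₁) - c (i + r₂)| ≤
      4 * θ + (r₁ + r₂) := by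
    intro M hM
    have key := sum_commutator_le c hA hB hab haB (M := M - (r₁ + r₂))
    by_cases hlt : r₁ + r₂ ≤ M
    · obtain ⟨M', rfl⟩ := Nat.exists_eq_add_of_le' hlt
      rw [Finset.sum_range_add]
      have h1 := key (by omega)
      rw [Nat.add_sub_cancel] at h1
      have h2 := Finset.sum_le_card_nsmul (Finset.range (r₁ + r₂))
        (fun i => |c (M' + i + r₁) - c (M' + i + r₂)|) 1 fun i _ => hc _ _
      simp at h2
      linarith
    · have h2 := Finset.sum_le_card_nsmul (Finset.range M)
        (fun i => |c (i + r₁) - c (i + r₂)|) 1 fun i _ => hc _ _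
      simp at h2
      have : (M : ℝ) ≤ r₁ + r₂ := by exact_mod_cast (not_le.1 hlt).le
      linarith
  induction n with
  | zero => intro M hM _ _; simp [show M = 0 by omega]
  | succ n ih =>
    intro M hM h1 h2
    have hn : (0 : ℝ) ≤ n * (6 * θ + (r₁ + r₂)) := by positivity
    push_cast
    by_cases hle : M ≤ a
    · have := base M hle; linarith
    · obtain ⟨M', rfl⟩ := Nat.exists_eq_add_of_le (not_le.1 hle).le
      rw [Finset.sum_range_add]
      have i1 := base a le_rfl
      have i2 := ih M' (by rw [add_mul] at hM; omega) (by omega) (by omega)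
      have i3 := sum_abs_sub_le_shiftDefect c (h := h) (k := a) (o := r₁) (M := M') (by omega)
      have i4 := sum_abs_sub_le_shiftDefect c (h := h) (k := a) (o := r₂) (M := M') (by omega)
      have i5 : ∑ i ∈ Finset.range M', |c (a + i + r₁) - c (a + i + r₂)| ≤
          ∑ i ∈ Finset.range M', (|c (i + r₁) - c (i + r₁ + a)| + |c (i + r₁) - c (i + r₂)| +
            |c (i + r₂) - c (i + r₂ + a)|) := by
        refine Finset.sum_le_sum fun i _ => ?_
        rw [show a + i + r₁ = i + r₁ + a by omega, show a + i + r₂ = i + r₂ + a by omega]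
        have := abs_sub_le (c (i + r₁ + a)) (c (i + r₁)) (c (i + r₂ + a))
        have := abs_sub_le (c (i + r₁)) (c (i + r₂)) (c (i + r₂ + a))
        have := abs_sub_comm (c (i + r₁ + a)) (c (i + r₁))
        linarith
      simp only [Finset.sum_add_distrib] at i5
      linarith

/-- The gap `r` between two consecutive passages through a tower of height `h` is admissible if
`h + r` is a sum of two approximate periods of the word `c`, up to an error `θ`, neither of them
shorter than `ℓ`. -/
def IsAdmissibleGap (c : ℕ → ℝ) (h : ℕ) (ℓ θ : ℝ) (r : ℕ) : Prop :=
  ∃ a A : ℕ, a + A = h + r ∧ ℓ ≤ a ∧ ℓ ≤ A ∧ shiftDefect c h a ≤ θ ∧ shiftDefect c h A ≤ θ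

/-- The shifts of the word by any two admissible gaps are close to each other. -/
lemma IsAdmissibleGap.sum_le {c : ℕ → ℝ} (hc : ∀ i j, |c i - c j| ≤ 1) {h r₁ r₂ : ℕ} {ℓ θ : ℝ}
    (H₁ : IsAdmissibleGap c h ℓ θ r₁) (H₂ : IsAdmissibleGap c h ℓ θ r₂) {n M : ℕ}
    (hn : (h : ℝ) ≤ n * ℓ) (h₁ : M + r₁ ≤ h) (h₂ : M + r₂ ≤ h) :
    ∑ i ∈ Finset.range M, |c (i + r₁) - c (i + r₂)| ≤ n * (6 * θ + (r₁ + r₂)) := by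
  have ordered : ∀ {r}, IsAdmissibleGap c h ℓ θ r → ∃ a A : ℕ, a ≤ A ∧ a + A = h + r ∧ ℓ ≤ a ∧
      shiftDefect c h a ≤ θ ∧ shiftDefect c h A ≤ θ := by
    rintro r ⟨a, A, e, la, lA, da, dA⟩
    rcases le_total a A with hle | hle
    · exact ⟨a, A, hle, e, la, da, dA⟩
    · exact ⟨A, a, hle, by omega, lA, dA, da⟩
  obtain ⟨a, A, aA, e1, la, da, dA⟩ := ordered H₁
  obtain ⟨b, B, bB, e2, lb, db, dB⟩ := ordered H₂
  have cover : ∀ x : ℕ, ℓ ≤ x → M ≤ n * x := by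
    intro x hx
    have : (M : ℝ) ≤ n * x := by
      have : (M : ℝ) ≤ h := by exact_mod_cast (by omega : M ≤ h)
      have := mul_le_mul_of_nonneg_left hx (Nat.cast_nonneg (α := ℝ) n)
      linarith
    exact_mod_cast this
  rcases le_total a b with hab | hab
  · exact sum_shift_le_of_periods c hc e1 e2 hab (hab.trans bB) da dA db dB n M
      (cover a la) h₁ h₂
  · have := sum_shift_le_of_periods c hc e2 e1 hab (hab.trans aA) db dB da dA n M
      (cover b lb) h₂ h₁
    simp only [abs_sub_comm (c (_ + r₂))] at this
    linarith

/-! ### Integrals over couplings -/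

section Generalities

variable {Ω X : Type*} [MeasurableSpace Ω] [MeasurableSpace X]

lemma setIntegral_biUnion_of_eqOn_const {ι : Type*} {ν : Measure Ω} [IsFiniteMeasure ν]
    (S : Finset ι) {P : ι → Set Ω} (hP : ∀ i ∈ S, MeasurableSet (P i))
    (hd : Set.Pairwise (↑S) (Function.onFun Disjoint P)) {F : Ω → ℝ} {H : ι → ℝ}
    (hF : ∀ i ∈ S, ∀ ω ∈ P i, F ω = H i) :
    ∫ ω in ⋃ i ∈ S, P i, F ω ∂ν = ∑ i ∈ S, ν.real (P i) * H i := by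
  rw [integral_biUnion_finset S hP hd]
  · refine Finset.sum_congr rfl fun i hi => ?_
    rw [setIntegral_congr_fun (hP i hi) (hF i hi), setIntegral_const, smul_eq_mul]
  · intro i hi
    exact (integrableOn_const (C := H i) (by simp)).congr_fun
      (fun ω hω => (hF i hi ω hω).symm) (hP i hi)

/-- Replacing a function by an `L¹`-close one changes the mean distance between its values at the
two points of a coupling by at most twice their `L¹`-distance. -/
lemma setIntegral_abs_sub_le_of_coupling {ν : Measure Ω} {μ : Measure X} {π₁ π₂ : Ω → X}
    (h₁ : MeasurePreserving π₁ ν μ) (h₂ : MeasurePreserving π₂ ν μ) {F G : X → ℝ}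
    (hF : Integrable F μ) (hG : Integrable G μ) (U : Set Ω) :
    ∫ ω in U, |F (π₁ ω) - F (π₂ ω)| ∂ν ≤
      ∫ ω in U, |G (π₁ ω) - G (π₂ ω)| ∂ν + 2 * ∫ x, |F x - G x| ∂μ := by
  have iF₁ := h₁.integrable_comp_of_integrable hF
  have iF₂ := h₂.integrable_comp_of_integrable hF
  have iG₁ := h₁.integrable_comp_of_integrable hG
  have iG₂ := h₂.integrable_comp_of_integrable hG
  have iGG : Integrable (fun ω => |G (π₁ ω) - G (π₂ ω)|) ν := (iG₁.sub iG₂).abs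
  have iFF : Integrable (fun ω => |F (π₁ ω) - F (π₂ ω)|) ν := (iF₁.sub iF₂).abs
  have i1 : Integrable (fun ω => |F (π₁ ω) - G (π₁ ω)|) ν := (iF₁.sub iG₁).abs
  have i2 : Integrable (fun ω => |F (π₂ ω) - G (π₂ ω)|) ν := (iF₂.sub iG₂).abs
  have iFG : Integrable (fun x => |F x - G x|) μ := (hF.sub hG).abs
  have e1 : ∫ ω, |F (π₁ ω) - G (π₁ ω)| ∂ν = ∫ x, |F x - G x| ∂μ := by
    rw [← h₁.map_eq, integral_map h₁.aemeasurable]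
    rw [h₁.map_eq]; exact iFG.aestronglyMeasurable
  have e2 : ∫ ω, |F (π₂ ω) - G (π₂ ω)| ∂ν = ∫ x, |F x - G x| ∂μ := by
    rw [← h₂.map_eq, integral_map h₂.aemeasurable]
    rw [h₂.map_eq]; exact iFG.aestronglyMeasurable
  calc ∫ ω in U, |F (π₁ ω) - F (π₂ ω)| ∂ν
      ≤ ∫ ω in U, (|G (π₁ ω) - G (π₂ ω)| +
          (|F (π₁ ω) - G (π₁ ω)| + |F (π₂ ω) - G (π₂ ω)|)) ∂ν := by
        refine integral_mono iFF.integrableOn (iGG.add (i1.add i2)).integrableOn fun ω => ?_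
        have := abs_sub_le (F (π₁ ω)) (G (π₁ ω)) (F (π₂ ω))
        have := abs_sub_le (G (π₁ ω)) (G (π₂ ω)) (F (π₂ ω))
        have := abs_sub_comm (G (π₂ ω)) (F (π₂ ω))
        simp only
        linarith
    _ = ∫ ω in U, |G (π₁ ω) - G (π₂ ω)| ∂ν +
          ∫ ω in U, (|F (π₁ ω) - G (π₁ ω)| + |F (π₂ ω) - G (π₂ ω)|) ∂ν :=
        integral_add iGG.integrableOn (i1.add i2).integrableOn
    _ ≤ _ := by
        have : ∫ ω in U, (|F (π₁ ω) - G (π₁ ω)| + |F (π₂ ω) - G (π₂ ω)|) ∂ν ≤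
            ∫ ω, (|F (π₁ ω) - G (π₁ ω)| + |F (π₂ ω) - G (π₂ ω)|) ∂ν :=
          setIntegral_le_integral (i1.add i2)
            (Eventually.of_forall fun ω => add_nonneg (abs_nonneg _) (abs_nonneg _))
        rw [integral_add i1 i2, e1, e2] at this
        linarith

lemma integral_abs_sub_le_of_coupling {ν : Measure Ω} {μ : Measure X} {π₁ π₂ : Ω → X}
    (h₁ : MeasurePreserving π₁ ν μ) (h₂ : MeasurePreserving π₂ ν μ) {F G : X → ℝ}
    (hF : Integrable F μ) (hG : Integrable G μ) :
    ∫ ω, |F (π₁ ω) - F (π₂ ω)| ∂ν ≤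
      ∫ ω, |G (π₁ ω) - G (π₂ ω)| ∂ν + 2 * ∫ x, |F x - G x| ∂μ := by
  simpa using setIntegral_abs_sub_le_of_coupling h₁ h₂ hF hG Set.univ

lemma abs_sub_le_one_of_mem_Icc {a b : ℝ} (ha : a ∈ Set.Icc (0 : ℝ) 1)
    (hb : b ∈ Set.Icc (0 : ℝ) 1) : |a - b| ≤ 1 := by
  rw [abs_le]; constructor <;> linarith [ha.1, ha.2, hb.1, hb.2]

lemma integrable_of_measurable_of_mem_Icc {μ : Measure X} [IsFiniteMeasure μ] {u : X → ℝ}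
    (hu : Measurable u) (h : ∀ x, u x ∈ Set.Icc (0 : ℝ) 1) : Integrable u μ :=
  Integrable.of_mem_Icc 0 1 hu.aemeasurable (Eventually.of_forall h)

end Generalities

/-! ### Positions in a tower -/

section Towers

variable {X : Type*} [MeasurableSpace X]

/-- The `L¹`-distance between a function and its translate along the flow. -/
noncomputable def displacement (μ : Measure X) (T : ℝ → X → X) (u : X → ℝ) (t : ℝ) : ℝ :=
  ∫ x, |u (T t x) - u x| ∂μ

/-- `p` assigns to the points of a tower of height `h` and step `s` the number of their level, and
the value `h` to all points outside of the tower. Moving up `n` levels is stated as an equivalence,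
which also says that a point `n` steps before the level `i + n` lies in the tower. -/
structure IsTowerPosition (T : ℝ → X → X) (s : ℝ) (h : ℕ) (p : X → ℕ) : Prop where
  measurable : Measurable p
  le : ∀ x, p x ≤ h
  shift : ∀ i n x, i + n < h → (p (T ((n : ℝ) * s) x) = i + n ↔ p x = i)

/-- A self-joining of the flow: a coupling of `μ` with itself that is invariant under the diagonal
action. -/
structure IsSelfJoining (T : ℝ → X → X) (μ : Measure X) (ν : Measure (X × X)) : Prop where
  fst : MeasurePreserving Prod.fst ν μ
  snd : MeasurePreserving Prod.snd ν μ
  invariant : ∀ t, MeasurePreserving (Prod.map (T t) (T t)) ν ν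

variable {μ : Measure X} {T : ℝ → X → X} {s : ℝ} {h : ℕ} {p : X → ℕ}

lemma displacement_nonneg (u : X → ℝ) (t : ℝ) : 0 ≤ displacement μ T u t :=
  integral_nonneg fun _ => abs_nonneg _

lemma IsTowerPosition.shift_of_lt (hp : IsTowerPosition T s h p) {x : X} {n : ℕ}
    (hx : p x + n < h) : p (T ((n : ℝ) * s) x) = p x + n :=
  (hp.shift (p x) n x hx).2 rfl

lemma IsTowerPosition.measurableSet_eq (hp : IsTowerPosition T s h p) (i : ℕ) :
    MeasurableSet {x | p x = i} :=
  hp.measurable (measurableSet_singleton i)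

lemma IsTowerPosition.measureReal_level (hT : IsFlow μ T) (hp : IsTowerPosition T s h p) {i : ℕ}
    (hi : i < h) : μ.real {x | p x = i} = μ.real {x | p x = 0} := by
  rw [← (hT.measurePreserving (i * s)).measureReal_preimage (hp.measurableSet_eq i).nullMeasurableSet]
  congr 1
  ext x
  simpa using hp.shift 0 i x (by omega)

lemma IsTowerPosition.setIntegral_comp [IsFiniteMeasure μ] (hT : IsFlow μ T)
    (hp : IsTowerPosition T s h p) {M : ℕ} (hM : M ≤ h) (H : ℕ → ℝ) :
    ∫ x in {x | p x < M}, H (p x) ∂μ = μ.real {x | p x = 0} * ∑ i ∈ Finset.range M, H i := by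
  have hU : {x | p x < M} = ⋃ i ∈ Finset.range M, {x | p x = i} := by
    ext x; simp
  rw [hU, setIntegral_biUnion_of_eqOn_const (F := fun x => H (p x)) (P := fun i => {x | p x = i})
      (H := H) (Finset.range M)
    (fun i _ => hp.measurableSet_eq i), Finset.mul_sum]
  · refine Finset.sum_congr rfl fun i hi => ?_
    rw [hp.measureReal_level hT (lt_of_lt_of_le (Finset.mem_range.1 hi) hM)]
  · intro i _ j _ hij
    exact Set.disjoint_left.2 fun x (hx : p x = i) (hx' : p x = j) => hij (hx.symm.trans hx')
  · intro i _ x hx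
    rw [show p x = i from hx]

lemma IsTowerPosition.measureReal_lt [IsFiniteMeasure μ] (hT : IsFlow μ T)
    (hp : IsTowerPosition T s h p) {M : ℕ} (hM : M ≤ h) :
    μ.real {x | p x < M} = M * μ.real {x | p x = 0} := by
  have := hp.setIntegral_comp hT hM (fun _ => 1)
  simp only [setIntegral_const, Finset.sum_const, Finset.card_range, nsmul_eq_mul, mul_one,
    smul_eq_mul] at this
  linarith

lemma IsTowerPosition.measurable_comp (hp : IsTowerPosition T s h p) (c : ℕ → ℝ) :
    Measurable fun x => c (p x) :=
  (measurable_of_countable c).comp hp.measurable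

lemma IsTowerPosition.integrable_comp [IsFiniteMeasure μ] (hp : IsTowerPosition T s h p)
    {c : ℕ → ℝ} (hc : ∀ i, c i ∈ Set.Icc (0 : ℝ) 1) : Integrable (fun x => c (p x)) μ :=
  integrable_of_measurable_of_mem_Icc (hp.measurable_comp c) fun _ => hc _

/-- The word of a function inherits the approximate periods of the function. -/
lemma IsTowerPosition.measure_mul_shiftDefect_le [IsProbabilityMeasure μ] (hT : IsFlow μ T)
    (hp : IsTowerPosition T s h p) {c : ℕ → ℝ} (hc : ∀ i, c i ∈ Set.Icc (0 : ℝ) 1) {u : X → ℝ}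
    (hu : Integrable u μ) (k : ℕ) :
    μ.real {x | p x = 0} * shiftDefect c h k ≤
      displacement μ T u (k * s) + 2 * ∫ x, |u x - c (p x)| ∂μ := by
  have h1 := hp.setIntegral_comp hT (Nat.sub_le h k) (fun i => |c i - c (i + k)|)
  rw [shiftDefect, ← h1]
  have mp := hT.measurePreserving (k * s)
  have h2 := integral_abs_sub_le_of_coupling mp (MeasurePreserving.id μ)
    (hp.integrable_comp hc) hu
  have i1 : Integrable (fun x => |c (p (T (k * s) x)) - c (p x)|) μ :=
    ((mp.integrable_comp_of_integrable (hp.integrable_comp hc)).sub (hp.integrable_comp hc)).abs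
  calc ∫ x in {x | p x < h - k}, |c (p x) - c (p x + k)| ∂μ
      = ∫ x in {x | p x < h - k}, |c (p (T (k * s) x)) - c (p x)| ∂μ := by
        refine setIntegral_congr_fun (hp.measurable (measurableSet_Iio (a := h - k)))
          fun x hx => ?_
        have hx' : p x < h - k := hx
        rw [hp.shift_of_lt (by omega), abs_sub_comm]
    _ ≤ ∫ x, |c (p (T (k * s) x)) - c (p x)| ∂μ :=
        setIntegral_le_integral i1 (Eventually.of_forall fun _ => abs_nonneg _)
    _ ≤ _ := by
        simp only [id, abs_sub_comm (c _) (u _)] at h2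
        exact h2

/-- Conversely, a short approximate period of the word of `u` hardly moves `u`. The last term
accounts for the points that are outside of the tower or leave it. -/
lemma IsTowerPosition.displacement_le [IsProbabilityMeasure μ] (hT : IsFlow μ T)
    (hp : IsTowerPosition T s h p) {c : ℕ → ℝ} (hc : ∀ i, c i ∈ Set.Icc (0 : ℝ) 1) {u : X → ℝ}
    (hu : Integrable u μ) (k : ℕ) :
    displacement μ T u (k * s) ≤ μ.real {x | p x = 0} * shiftDefect c h k +
      2 * ∫ x, |u x - c (p x)| ∂μ + (1 - (h - k : ℕ) * μ.real {x | p x = 0}) := by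
  have mp := hT.measurePreserving (k * s)
  have h1 := hp.setIntegral_comp hT (Nat.sub_le h k) (fun i => |c i - c (i + k)|)
  have hm : MeasurableSet {x | p x < h - k} := hp.measurable (measurableSet_Iio (a := h - k))
  have h2 := integral_abs_sub_le_of_coupling mp (MeasurePreserving.id μ) hu
    (hp.integrable_comp hc)
  have i1 : Integrable (fun x => |c (p (T (k * s) x)) - c (p x)|) μ :=
    ((mp.integrable_comp_of_integrable (hp.integrable_comp hc)).sub (hp.integrable_comp hc)).abs
  have h3 : ∫ x in {x | p x < h - k}, |c (p (T (k * s) x)) - c (p x)| ∂μ =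
      ∫ x in {x | p x < h - k}, |c (p x) - c (p x + k)| ∂μ := by
    refine setIntegral_congr_fun hm fun x hx => ?_
    have hx' : p x < h - k := hx
    rw [hp.shift_of_lt (by omega), abs_sub_comm]
  have h4 : ∫ x in {x | p x < h - k}ᶜ, |c (p (T (k * s) x)) - c (p x)| ∂μ ≤
      1 - (h - k : ℕ) * μ.real {x | p x = 0} := by
    rw [← hp.measureReal_lt hT (Nat.sub_le h k), ← probReal_compl_eq_one_sub hm]
    have := integral_mono (μ := μ.restrict {x | p x < h - k}ᶜ) i1.integrableOn
      (integrable_const (1 : ℝ)) fun x => abs_sub_le_one_of_mem_Icc (hc _) (hc _)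
    simpa using this
  have h5 := integral_add_compl hm i1
  simp only [id] at h2
  rw [displacement, shiftDefect, ← h1]
  linarith

/-- Within the tower, a self-joining is a combination of diagonals: it gives the same mass to all
the products of two levels with a given difference `k` of their numbers. -/
lemma IsTowerPosition.setIntegral_selfJoining {ν : Measure (X × X)} [IsProbabilityMeasure ν]
    (hp : IsTowerPosition T s h p) (hν : IsSelfJoining T μ ν) {K : Finset ℕ}
    (hK : ∀ k ∈ K, k < h) (H : ℕ → ℕ → ℝ) :
    ∫ z in {z | p z.1 ≤ p z.2 ∧ p z.2 < h ∧ p z.2 - p z.1 ∈ K}, H (p z.1) (p z.2) ∂ν =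
      ∑ k ∈ K, ν.real {z | p z.1 = 0 ∧ p z.2 = k} * ∑ i ∈ Finset.range (h - k), H i (i + k) := by
  have hm : ∀ i j : ℕ, MeasurableSet {z : X × X | p z.1 = i ∧ p z.2 = j} := fun i j =>
    (measurable_fst (hp.measurableSet_eq i)).inter (measurable_snd (hp.measurableSet_eq j))
  have hU : {z : X × X | p z.1 ≤ p z.2 ∧ p z.2 < h ∧ p z.2 - p z.1 ∈ K} =
      ⋃ a ∈ K.sigma (fun k => Finset.range (h - k)),
        {z : X × X | p z.1 = a.2 ∧ p z.2 = a.2 + a.1} := by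
    ext z
    simp only [Set.mem_ofPred_eq, Set.mem_iUnion, Finset.mem_sigma, Finset.mem_range, exists_prop,
      Sigma.exists]
    constructor
    · rintro ⟨h1, h2, h3⟩
      exact ⟨p z.2 - p z.1, p z.1, ⟨h3, by omega⟩, rfl, by omega⟩
    · rintro ⟨k, i, ⟨hk, hi⟩, h1, h2⟩
      rw [h1, h2]
      exact ⟨by omega, by omega, by simpa using hk⟩
  rw [hU, setIntegral_biUnion_of_eqOn_const (F := fun z : X × X => H (p z.1) (p z.2))
    (P := fun a : (_ : ℕ) × ℕ => {z : X × X | p z.1 = a.2 ∧ p z.2 = a.2 + a.1})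
    (H := fun a => H a.2 (a.2 + a.1)) _ (fun a _ => hm _ _), Finset.sum_sigma]
  · refine Finset.sum_congr rfl fun k hk => ?_
    rw [Finset.mul_sum]
    refine Finset.sum_congr rfl fun i hi => ?_
    congr 1
    rw [← (hν.invariant (i * s)).measureReal_preimage (hm _ _).nullMeasurableSet]
    congr 1
    ext z
    have hi' := Finset.mem_range.1 hi
    have hk' := hK k hk
    have h1 := hp.shift 0 i z.1 (by omega)
    have h2 := hp.shift k i z.2 (by omega)
    rw [zero_add] at h1
    simp only [Set.mem_preimage, Set.mem_ofPred_eq, Prod.map_fst, Prod.map_snd]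
    rw [h1, add_comm i k, h2]
  · rintro ⟨k, i⟩ _ ⟨k', i'⟩ _ hne
    refine Set.disjoint_left.2 fun z hz hz' => hne ?_
    obtain ⟨h1, h2⟩ := hz
    obtain ⟨h3, h4⟩ := hz'
    simp only at h1 h2 h3 h4
    obtain rfl : i = i' := by omega
    obtain rfl : k = k' := by omega
    rfl
  · rintro ⟨k, i⟩ _ z ⟨h1, h2⟩
    rw [h1, h2]

end Towers

/-! ### A self-joining seen in a single tower -/

section SingleTower

variable {X : Type*} [MeasurableSpace X] {μ : Measure X} {T : ℝ → X → X} {s : ℝ} {h : ℕ}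
  {p : X → ℕ} {ν : Measure (X × X)}

/-- The pairs of points of a tower, the second one not below the first one, for which the
difference of the level numbers belongs to `K`. -/
def ascendingPairs (p : X → ℕ) (h : ℕ) (K : Finset ℕ) : Set (X × X) :=
  {z | p z.1 ≤ p z.2 ∧ p z.2 < h ∧ p z.2 - p z.1 ∈ K}

lemma IsSelfJoining.swap (hν : IsSelfJoining T μ ν) : IsSelfJoining T μ (ν.map Prod.swap) where
  fst := ⟨measurable_fst, by
    rw [Measure.map_map measurable_fst measurable_swap]; exact hν.snd.map_eq⟩
  snd := ⟨measurable_snd, by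
    rw [Measure.map_map measurable_snd measurable_swap]; exact hν.fst.map_eq⟩
  invariant t := ⟨(hν.invariant t).measurable, by
    rw [Measure.map_map (hν.invariant t).measurable measurable_swap]
    conv_rhs => rw [← (hν.invariant t).map_eq]
    rw [Measure.map_map measurable_swap (hν.invariant t).measurable]
    rfl⟩

lemma IsTowerPosition.measurableSet_ascendingPairs (hp : IsTowerPosition T s h p) (K : Finset ℕ) :
    MeasurableSet (ascendingPairs p h K) := by
  have h1 : Measurable fun z : X × X => p z.1 := hp.measurable.comp measurable_fst
  have h2 : Measurable fun z : X × X => p z.2 := hp.measurable.comp measurable_snd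
  exact (measurableSet_le h1 h2).inter ((measurableSet_lt h2 measurable_const).inter
    ((h2.sub h1) K.measurableSet))

/-- A self-joining for which `f` takes equal values at both points is carried by the diagonals
that are approximate periods of the word of `f`. -/
lemma IsTowerPosition.measureReal_ascendingPairs_le_of_defect [IsProbabilityMeasure μ]
    [IsProbabilityMeasure ν] (hp : IsTowerPosition T s h p) (hν : IsSelfJoining T μ ν) {c : ℕ → ℝ}
    (hc : ∀ i, c i ∈ Set.Icc (0 : ℝ) 1) {f : X → ℝ} (hf : Integrable f μ)
    (hfν : ∀ᵐ z ∂ν, f z.1 = f z.2) {θ : ℝ} (hθ : 0 ≤ θ) {K : Finset ℕ} (hK : ∀ k ∈ K, k < h)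
    (hKθ : ∀ k ∈ K, θ * h ≤ shiftDefect c h k) :
    θ * ν.real (ascendingPairs p h K) ≤ 2 * ∫ x, |f x - c (p x)| ∂μ := by
  have h1 := hp.setIntegral_selfJoining hν hK (fun _ _ => 1)
  have h2 := hp.setIntegral_selfJoining hν hK (fun i j => |c i - c j|)
  have h3 := setIntegral_abs_sub_le_of_coupling hν.fst hν.snd (hp.integrable_comp hc) hf
    (ascendingPairs p h K)
  have h4 : ∫ z in ascendingPairs p h K, |f z.1 - f z.2| ∂ν = 0 := by
    rw [integral_congr_ae (g := fun _ => (0 : ℝ))]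
    · simp
    · filter_upwards [ae_restrict_of_ae hfν] with z hz
      simp [hz]
  rw [h4, zero_add] at h3
  simp only [abs_sub_comm (c _) (f _)] at h3
  refine le_trans ?_ h3
  simp only [setIntegral_const, Finset.sum_const, Finset.card_range, nsmul_eq_mul, mul_one,
    smul_eq_mul] at h1
  change ν.real (ascendingPairs p h K) = _ at h1
  change ∫ z in ascendingPairs p h K, |c (p z.1) - c (p z.2)| ∂ν = _ at h2
  rw [h1, h2, Finset.mul_sum]
  refine Finset.sum_le_sum fun k hk => ?_
  have hN : 0 ≤ ν.real {z : X × X | p z.1 = 0 ∧ p z.2 = k} := measureReal_nonneg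
  have hle : θ * ((h - k : ℕ) : ℝ) ≤ shiftDefect c h k :=
    (mul_le_mul_of_nonneg_left (by exact_mod_cast Nat.sub_le h k) hθ).trans (hKθ k hk)
  rw [shiftDefect] at hle
  calc _ = ν.real {z : X × X | p z.1 = 0 ∧ p z.2 = k} * (θ * ((h - k : ℕ) : ℝ)) := by ring
    _ ≤ _ := mul_le_mul_of_nonneg_left hle hN

/-- Diagonals that hardly move a function `g` separating the points have small mass under a
self-joining that does not charge the diagonal. -/
lemma IsTowerPosition.measureReal_ascendingPairs_le_of_short [IsProbabilityMeasure μ]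
    [IsProbabilityMeasure ν] (hp : IsTowerPosition T s h p) (hν : IsSelfJoining T μ ν) {c : ℕ → ℝ}
    (hc : ∀ i, c i ∈ Set.Icc (0 : ℝ) 1) {g : X → ℝ} (hg : Measurable g) (hgi : Integrable g μ)
    {ω σ : ℝ} (hω : 0 ≤ ω) (hσ : 0 ≤ σ) {K : Finset ℕ} (hK : ∀ k ∈ K, k < h)
    (hKh : ∀ k ∈ K, 2 * k ≤ h) (hKω : ∀ k ∈ K, shiftDefect c h k ≤ ω * h) :
    σ * ν.real (ascendingPairs p h K) ≤ σ * ν.real {z | |g z.1 - g z.2| < σ} +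
      (2 * ω + 2 * ∫ x, |g x - c (p x)| ∂μ) := by
  have h1 := hp.setIntegral_selfJoining hν hK (fun _ _ => 1)
  have h2 := hp.setIntegral_selfJoining hν hK (fun i j => |c i - c j|)
  have h3 := setIntegral_abs_sub_le_of_coupling hν.fst hν.snd hgi (hp.integrable_comp hc)
    (ascendingPairs p h K)
  simp only [setIntegral_const, Finset.sum_const, Finset.card_range, nsmul_eq_mul, mul_one,
    smul_eq_mul] at h1
  change ν.real (ascendingPairs p h K) = _ at h1
  change ∫ z in ascendingPairs p h K, |c (p z.1) - c (p z.2)| ∂ν = _ at h2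
  have h4 : ∫ z in ascendingPairs p h K, |c (p z.1) - c (p z.2)| ∂ν ≤ 2 * ω := by
    have : ∫ z in ascendingPairs p h K, |c (p z.1) - c (p z.2)| ∂ν ≤
        2 * ω * ν.real (ascendingPairs p h K) := by
      rw [h1, h2, Finset.mul_sum]
      refine Finset.sum_le_sum fun k hk => ?_
      have hN : 0 ≤ ν.real {z : X × X | p z.1 = 0 ∧ p z.2 = k} := measureReal_nonneg
      have hle : shiftDefect c h k ≤ 2 * ω * ((h - k : ℕ) : ℝ) := by
        have : (h : ℝ) ≤ 2 * ((h - k : ℕ) : ℝ) := by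
          have := hKh k hk
          exact_mod_cast (by omega : h ≤ 2 * (h - k))
        calc _ ≤ ω * h := hKω k hk
          _ ≤ ω * (2 * ((h - k : ℕ) : ℝ)) := mul_le_mul_of_nonneg_left this hω
          _ = _ := by ring
      rw [shiftDefect] at hle
      calc _ ≤ ν.real {z : X × X | p z.1 = 0 ∧ p z.2 = k} * (2 * ω * ((h - k : ℕ) : ℝ)) :=
            mul_le_mul_of_nonneg_left hle hN
        _ = _ := by ring
    refine this.trans ?_
    have := measureReal_le_one (μ := ν) (s := ascendingPairs p h K)
    nlinarith
  have hgm : Measurable fun z : X × X => |g z.1 - g z.2| :=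
    ((hg.comp measurable_fst).sub (hg.comp measurable_snd)).abs
  have hU := hp.measurableSet_ascendingPairs K
  set W : Set (X × X) := {z | |g z.1 - g z.2| < σ} with hW
  have hWm : MeasurableSet W := measurableSet_lt hgm measurable_const
  have h5 : σ * ν.real (ascendingPairs p h K \ W) ≤
      ∫ z in ascendingPairs p h K, |g z.1 - g z.2| ∂ν := by
    have i1 : Integrable (fun z : X × X => |g z.1 - g z.2|) ν :=
      ((hν.fst.integrable_comp_of_integrable hgi).sub
        (hν.snd.integrable_comp_of_integrable hgi)).abs
    calc σ * ν.real (ascendingPairs p h K \ W)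
        = ∫ z in ascendingPairs p h K \ W, σ ∂ν := by simp [mul_comm]
      _ ≤ ∫ z in ascendingPairs p h K \ W, |g z.1 - g z.2| ∂ν :=
          setIntegral_mono_on (integrable_const _) i1.integrableOn (hU.diff hWm)
            fun z hz => not_lt.1 hz.2
      _ ≤ _ := setIntegral_mono_set i1.integrableOn
          (Eventually.of_forall fun _ => abs_nonneg _) (Eventually.of_forall fun z hz => hz.1)
  have h6 : ν.real (ascendingPairs p h K) ≤ ν.real W + ν.real (ascendingPairs p h K \ W) := by
    refine le_trans (measureReal_mono ?_) (measureReal_union_le _ _)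
    intro z hz
    by_cases hzW : z ∈ W
    · exact Or.inl hzW
    · exact Or.inr ⟨hz, hzW⟩
  have := mul_le_mul_of_nonneg_left h6 hσ
  linarith

/-- The pairs of points of a tower whose level numbers differ by an approximate period of the word
`c` that is not short. -/
def typicalPairs (p : X → ℕ) (h : ℕ) (c : ℕ → ℝ) (ℓ θ : ℝ) : Set (X × X) :=
  {z | p z.1 < h ∧ p z.2 < h ∧
    (p z.1 ≤ p z.2 → ℓ ≤ (p z.2 - p z.1 : ℕ) ∧ shiftDefect c h (p z.2 - p z.1) ≤ θ) ∧
    (p z.2 ≤ p z.1 → ℓ ≤ (p z.1 - p z.2 : ℕ) ∧ shiftDefect c h (p z.1 - p z.2) ≤ θ)}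

open Classical in
/-- The pairs with a descending difference of levels are treated as ascending pairs of the swapped
self-joining. -/
lemma IsTowerPosition.measureReal_compl_typicalPairs_le [IsProbabilityMeasure μ]
    [IsProbabilityMeasure ν] (hp : IsTowerPosition T s h p) (hν : IsSelfJoining T μ ν)
    {c : ℕ → ℝ} {ℓ θ κ : ℝ}
    (hup : ν.real (ascendingPairs p h
      {k ∈ Finset.range h | ¬ (ℓ ≤ k ∧ shiftDefect c h k ≤ θ)}) ≤ κ)
    (hdown : (ν.map Prod.swap).real (ascendingPairs p h
      {k ∈ Finset.range h | ¬ (ℓ ≤ k ∧ shiftDefect c h k ≤ θ)}) ≤ κ) :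
    ν.real (typicalPairs p h c ℓ θ)ᶜ ≤ 2 * μ.real {x | ¬ p x < h} + 2 * κ := by
  set K : Finset ℕ := {k ∈ Finset.range h | ¬ (ℓ ≤ k ∧ shiftDefect c h k ≤ θ)} with hK
  have hm : MeasurableSet {x | ¬ p x < h} :=
    (hp.measurable (measurableSet_Iio (a := h))).compl
  rw [map_measureReal_apply measurable_swap (hp.measurableSet_ascendingPairs K)] at hdown
  have e1 := hν.fst.measureReal_preimage hm.nullMeasurableSet
  have e2 := hν.snd.measureReal_preimage hm.nullMeasurableSet
  have hsub : (typicalPairs p h c ℓ θ)ᶜ ⊆ ((Prod.fst ⁻¹' {x | ¬ p x < h}) ∪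
      (Prod.snd ⁻¹' {x | ¬ p x < h})) ∪
      (ascendingPairs p h K ∪ Prod.swap ⁻¹' ascendingPairs p h K) := by
    intro z hz
    by_contra hcon
    simp only [Set.mem_union, not_or, Set.mem_preimage, Set.mem_ofPred_eq, not_not] at hcon
    obtain ⟨⟨h1, h2⟩, h3, h4⟩ := hcon
    refine hz ⟨h1, h2, fun hle => ?_, fun hle => ?_⟩
    · by_contra hneg
      exact h3 ⟨hle, h2, Finset.mem_filter.2 ⟨Finset.mem_range.2 (by omega), hneg⟩⟩
    · by_contra hneg
      exact h4 ⟨hle, h1, Finset.mem_filter.2 ⟨Finset.mem_range.2 (by simp; omega), hneg⟩⟩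
  have := measureReal_mono (μ := ν) hsub
  have := measureReal_union_le (μ := ν) ((Prod.fst ⁻¹' {x | ¬ p x < h}) ∪
      (Prod.snd ⁻¹' {x | ¬ p x < h})) (ascendingPairs p h K ∪ Prod.swap ⁻¹' ascendingPairs p h K)
  have := measureReal_union_le (μ := ν) (Prod.fst ⁻¹' {x | ¬ p x < h})
      (Prod.snd ⁻¹' {x | ¬ p x < h})
  have := measureReal_union_le (μ := ν) (ascendingPairs p h K)
    (Prod.swap ⁻¹' ascendingPairs p h K)
  linarith

/-- The points of the base that return to the base after the time `h + r`, the gap between two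
passages through the tower thus being `r`. -/
def gapSet (T : ℝ → X → X) (s : ℝ) (h : ℕ) (p : X → ℕ) (r : ℕ) : Set X :=
  {x | p x = 0 ∧ p (T (((h + r : ℕ) : ℝ) * s) x) = 0}

lemma IsFlow.apply_neg_apply (hT : IsFlow μ T) (t : ℝ) (x : X) : T t (T (-t) x) = x := by
  rw [← hT.map_add, add_neg_cancel, hT.map_zero]

lemma IsFlow.apply_nat_add (hT : IsFlow μ T) (s : ℝ) (a b : ℕ) (x : X) :
    T ((a : ℝ) * s) (T ((b : ℝ) * s) x) = T (((a + b : ℕ) : ℝ) * s) x := by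
  rw [← hT.map_add, Nat.cast_add, add_mul]

lemma IsTowerPosition.measurableSet_gapSet (hT : IsFlow μ T) (hp : IsTowerPosition T s h p)
    (r : ℕ) : MeasurableSet (gapSet T s h p r) :=
  (hp.measurableSet_eq 0).inter ((hT.measurePreserving _).measurable (hp.measurableSet_eq 0))

/-- Two typical pairs on the same orbit, taken before and after the upper point has left the tower
and has returned to it, exhibit the gap in question as admissible. -/
lemma IsTowerPosition.mem_gapSet_of_typical (hT : IsFlow μ T) (hp : IsTowerPosition T s h p)
    {c : ℕ → ℝ} {ℓ θ : ℝ} {m : ℕ} (hmh : m ≤ h) (hℓ : (3 * m : ℝ) ≤ ℓ) {z : X × X}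
    (hz : h - m ≤ p z.2) (h₁ : z ∈ typicalPairs p h c ℓ θ)
    (h₂ : Prod.map (T ((2 * m : ℕ) * s)) (T ((2 * m : ℕ) * s)) z ∈ typicalPairs p h c ℓ θ) :
    ∃ r < 2 * m, IsAdmissibleGap c h ℓ θ r ∧ T (-((p z.2 : ℝ) * s)) z.2 ∈ gapSet T s h p r := by
  obtain ⟨x, y⟩ := z
  obtain ⟨h1, h2, h3, h4⟩ := h₁
  obtain ⟨h5, h6, h7, h8⟩ := h₂
  simp only [Prod.map_fst, Prod.map_snd] at h1 h2 h3 h4 h5 h6 h7 h8 hz ⊢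
  -- The point `y` is near the top and the difference of the levels is not short, so `x` is below.
  have hxy : p x < p y := by
    by_contra hle
    have h9 := (h4 (not_lt.1 hle)).1
    have : (3 * m : ℝ) ≤ (p x - p y : ℕ) := hℓ.trans h9
    have : 3 * m ≤ p x - p y := by exact_mod_cast this
    omega
  have hk := h3 hxy.le
  have hk' : 3 * m ≤ p y - p x := by
    have : (3 * m : ℝ) ≤ (p y - p x : ℕ) := hℓ.trans hk.1
    exact_mod_cast this
  have hx2 := hp.shift_of_lt (x := x) (n := 2 * m) (by omega)
  -- The point `y` has left the tower and has returned to a low level `l`, while `x` has only moved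
  -- up by `2 * m`. The two differences of levels add up to `h + r`, where `r` is the gap.
  set l := p (T ((2 * m : ℕ) * s) y) with hl
  have hl2 : l < 2 * m := by
    by_contra hle
    obtain ⟨a, ha⟩ := Nat.exists_eq_add_of_le' (not_lt.1 hle)
    have := (hp.shift a (2 * m) y (by omega)).1 (by rw [← hl, ha])
    omega
  have hbase : p (T ((2 * m - l : ℕ) * s) y) = 0 := by
    refine (hp.shift 0 l _ (by omega)).1 ?_
    rw [hT.apply_nat_add, Nat.add_sub_cancel' hl2.le, zero_add]
  have hv : h - p y ≤ 2 * m - l := by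
    by_contra hlt
    have := hp.shift_of_lt (x := y) (n := 2 * m - l) (by omega)
    omega
  have hy0 : p (T (-((p y : ℝ) * s)) y) = 0 := by
    refine (hp.shift 0 (p y) _ (by omega)).1 ?_
    rw [hT.apply_neg_apply, zero_add]
  refine ⟨2 * m - l - (h - p y), by omega, ⟨p y - p x, p x + 2 * m - l, by omega, hk.1, ?_, hk.2, ?_⟩,
    hy0, ?_⟩
  · have := (h8 (by omega)).1
    rwa [hx2] at this
  · have := (h8 (by omega)).2
    rwa [hx2] at this
  · have e : h + (2 * m - l - (h - p y)) = (2 * m - l) + p y := by omega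
    rw [e, ← hT.apply_nat_add, hT.apply_neg_apply, hbase]

open Classical in
/-- Most points of the base return to it after an admissible gap. The `m` uppermost levels of the
tower are considered: for most pairs whose second point lies there, `mem_gapSet_of_typical`
applies. -/
lemma IsTowerPosition.measure_base_le_sum_gapSet [IsProbabilityMeasure μ]
    [IsProbabilityMeasure ν] (hT : IsFlow μ T) (hp : IsTowerPosition T s h p)
    (hν : IsSelfJoining T μ ν) {c : ℕ → ℝ} {ℓ θ κ : ℝ} {m : ℕ} (hmh : m ≤ h)
    (hℓ : (3 * m : ℝ) ≤ ℓ) (hκ : ν.real (typicalPairs p h c ℓ θ)ᶜ ≤ κ) :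
    m * μ.real {x | p x = 0} ≤ 2 * κ +
      m * ∑ r ∈ Finset.range (2 * m) with IsAdmissibleGap c h ℓ θ r,
        μ.real (gapSet T s h p r) := by
  set R : Finset ℕ := {r ∈ Finset.range (2 * m) | IsAdmissibleGap c h ℓ θ r} with hR
  set V : Set X := {x | p x < h} \ {x | p x < h - m} with hV
  have hm1 : MeasurableSet {x | p x < h} := hp.measurable (measurableSet_Iio (a := h))
  have hm2 : MeasurableSet {x | p x < h - m} := hp.measurable (measurableSet_Iio (a := h - m))
  have hVm : μ.real V = m * μ.real {x | p x = 0} := by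
    have hss : {x | p x < h - m} ⊆ {x | p x < h} := fun x hx => lt_of_lt_of_le hx (Nat.sub_le h m)
    rw [hV, measureReal_sdiff hss hm2, hp.measureReal_lt hT le_rfl,
      hp.measureReal_lt hT (Nat.sub_le h m), Nat.cast_sub hmh]
    ring
  have hTyp : MeasurableSet (typicalPairs p h c ℓ θ) := by
    have : Measurable fun z : X × X => (p z.1, p z.2) :=
      (hp.measurable.comp measurable_fst).prodMk (hp.measurable.comp measurable_snd)
    exact this (MeasurableSet.of_discrete (s := {q : ℕ × ℕ | q.1 < h ∧ q.2 < h ∧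
      (q.1 ≤ q.2 → ℓ ≤ (q.2 - q.1 : ℕ) ∧ shiftDefect c h (q.2 - q.1) ≤ θ) ∧
      (q.2 ≤ q.1 → ℓ ≤ (q.1 - q.2 : ℕ) ∧ shiftDefect c h (q.1 - q.2) ≤ θ)}))
  set W : Set X := ⋃ i ∈ Finset.range m, ⋃ r ∈ R,
    T (-(((h - m + i : ℕ) : ℝ) * s)) ⁻¹' gapSet T s h p r with hW
  have hsub : Prod.snd ⁻¹' V ⊆ (typicalPairs p h c ℓ θ)ᶜ ∪
      (Prod.map (T ((2 * m : ℕ) * s)) (T ((2 * m : ℕ) * s)) ⁻¹' (typicalPairs p h c ℓ θ)ᶜ) ∪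
      (Prod.snd ⁻¹' W) := by
    rintro z ⟨hz1, hz2⟩
    by_contra hcon
    simp only [Set.mem_union, not_or, Set.mem_preimage, Set.mem_compl_iff, not_not] at hcon
    obtain ⟨⟨c1, c2⟩, c3⟩ := hcon
    have hz1' : p z.2 < h := hz1
    have hz2' : h - m ≤ p z.2 := not_lt.1 hz2
    obtain ⟨r, hr, hadm, hmem⟩ := hp.mem_gapSet_of_typical hT hmh hℓ hz2' c1 c2
    refine c3 ?_
    simp only [hW, Set.mem_iUnion]
    refine ⟨p z.2 - (h - m), Finset.mem_range.2 (by omega), r,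
      Finset.mem_filter.2 ⟨Finset.mem_range.2 hr, hadm⟩, ?_⟩
    rw [Set.mem_preimage, Nat.add_sub_cancel' hz2']
    exact hmem
  have hWle : μ.real W ≤ m * ∑ r ∈ R, μ.real (gapSet T s h p r) := by
    refine (measureReal_biUnion_finset_le _ _).trans ?_
    have : ∀ i ∈ Finset.range m, μ.real (⋃ r ∈ R,
        T (-(((h - m + i : ℕ) : ℝ) * s)) ⁻¹' gapSet T s h p r) ≤
        ∑ r ∈ R, μ.real (gapSet T s h p r) := by
      intro i _
      refine (measureReal_biUnion_finset_le _ _).trans (Finset.sum_le_sum fun r _ => ?_)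
      rw [(hT.measurePreserving _).measureReal_preimage
        (hp.measurableSet_gapSet hT r).nullMeasurableSet]
    refine (Finset.sum_le_card_nsmul _ _ _ this).trans ?_
    simp
  have hWm : MeasurableSet W := Finset.measurableSet_biUnion _ fun i _ =>
    Finset.measurableSet_biUnion _ fun r _ =>
      (hT.measurePreserving _).measurable (hp.measurableSet_gapSet hT r)
  have a1 := measureReal_mono (μ := ν) hsub
  have a2 := measureReal_union_le (μ := ν) ((typicalPairs p h c ℓ θ)ᶜ ∪
      (Prod.map (T ((2 * m : ℕ) * s)) (T ((2 * m : ℕ) * s)) ⁻¹' (typicalPairs p h c ℓ θ)ᶜ))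
      (Prod.snd ⁻¹' W)
  have a3 := measureReal_union_le (μ := ν) (typicalPairs p h c ℓ θ)ᶜ
      (Prod.map (T ((2 * m : ℕ) * s)) (T ((2 * m : ℕ) * s)) ⁻¹' (typicalPairs p h c ℓ θ)ᶜ)
  rw [(hν.invariant _).measureReal_preimage hTyp.compl.nullMeasurableSet] at a3
  rw [hν.snd.measureReal_preimage hWm.nullMeasurableSet] at a2
  rw [hν.snd.measureReal_preimage (hm1.diff hm2).nullMeasurableSet, hVm] at a1
  linarith

/-- If the words shifted by the gaps `r ∈ R` are all close to the word shifted by `r₀`, then the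
time `h + r₀` hardly moves `u`: a point at level `i + r` whose column has gap `r` is sent to the
level `i + r₀`. -/
lemma IsTowerPosition.displacement_le_of_gaps [IsProbabilityMeasure μ] (hT : IsFlow μ T)
    (hp : IsTowerPosition T s h p) {c : ℕ → ℝ} (hc : ∀ i, c i ∈ Set.Icc (0 : ℝ) 1) {u : X → ℝ}
    (hu : Integrable u μ) {m : ℕ} (hmh : 2 * m ≤ h) {R : Finset ℕ} (hR : ∀ r ∈ R, r < 2 * m)
    {r₀ : ℕ} (hr₀ : r₀ < 2 * m) {b : ℝ} (hb : 0 ≤ b)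
    (hRb : ∀ r ∈ R, ∑ i ∈ Finset.range (h - 2 * m), |c (i + r) - c (i + r₀)| ≤ b) :
    displacement μ T u ((h + r₀ : ℕ) * s) ≤ 2 * ∫ x, |u x - c (p x)| ∂μ +
      μ.real {x | p x = 0} * b +
      (1 - (h - 2 * m : ℕ) * ∑ r ∈ R, μ.real (gapSet T s h p r)) := by
  have mp := hT.measurePreserving ((h + r₀ : ℕ) * s)
  have disj : ∀ r < 2 * m, ∀ r' < 2 * m, r ≠ r' → ∀ x, x ∈ gapSet T s h p r →
      x ∉ gapSet T s h p r' := by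
    have aux : ∀ r < 2 * m, ∀ r' < 2 * m, r < r' → ∀ x, x ∈ gapSet T s h p r →
        x ∉ gapSet T s h p r' := by
      rintro r hr r' hr' hlt x ⟨_, h1⟩ ⟨_, h2⟩
      have := hp.shift_of_lt (x := T (((h + r : ℕ) : ℝ) * s) x) (n := r' - r) (by omega)
      rw [hT.apply_nat_add, show r' - r + (h + r) = h + r' by omega] at this
      omega
    intro r hr r' hr' hne x hx hx'
    rcases lt_or_gt_of_ne hne with hlt | hlt
    · exact aux r hr r' hr' hlt x hx hx'
    · exact aux r' hr' r hr hlt x hx' hx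
  have hsum : ∑ r ∈ R, μ.real (gapSet T s h p r) ≤ μ.real {x | p x = 0} := by
    rw [← measureReal_biUnion_finset (fun r hr r' hr' hne => Set.disjoint_left.2
      (disj r (hR r hr) r' (hR r' hr') hne)) fun r _ => hp.measurableSet_gapSet hT r]
    exact measureReal_mono (Set.iUnion₂_subset fun r _ x hx => hx.1)
  -- `P (r, i)` is the part of the level `i + r` that lies above `gapSet T s h p r`.
  set S := R ×ˢ Finset.range (h - 2 * m) with hS
  set P : ℕ × ℕ → Set X := fun a => T (-(((a.2 + a.1 : ℕ) : ℝ) * s)) ⁻¹' gapSet T s h p a.1 with hP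
  have hPm : ∀ a ∈ S, MeasurableSet (P a) := fun a _ =>
    (hT.measurePreserving _).measurable (hp.measurableSet_gapSet hT _)
  have hPμ : ∀ a, μ.real (P a) = μ.real (gapSet T s h p a.1) := fun a =>
    (hT.measurePreserving _).measureReal_preimage (hp.measurableSet_gapSet hT _).nullMeasurableSet
  have hpos : ∀ a ∈ S, ∀ x ∈ P a, p x = a.2 + a.1 ∧
      p (T ((h + r₀ : ℕ) * s) x) = a.2 + r₀ := by
    rintro ⟨r, i⟩ ha x ⟨hx1, hx2⟩
    obtain ⟨ha1, ha2⟩ := Finset.mem_product.1 ha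
    have hr := hR r ha1
    have hi := Finset.mem_range.1 ha2
    simp only at hx1 hx2 hi hr ⊢
    set x₀ := T (-(((i + r : ℕ) : ℝ) * s)) x with hx₀
    have hx : x = T (((i + r : ℕ) : ℝ) * s) x₀ := (hT.apply_neg_apply _ _).symm
    constructor
    · rw [hx, hp.shift_of_lt (by omega)]; omega
    · rw [hx, hT.apply_nat_add, show h + r₀ + (i + r) = (i + r₀) + (h + r) by omega,
        ← hT.apply_nat_add, hp.shift_of_lt (by omega)]
      omega
  have hPd : Set.Pairwise (↑S : Set (ℕ × ℕ)) (Function.onFun Disjoint P) := by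
    rintro ⟨r, i⟩ ha ⟨r', i'⟩ ha' hne
    refine Set.disjoint_left.2 fun x hx hx' => ?_
    have e1 := (hpos _ ha x hx).1
    have e2 := (hpos _ ha' x hx').1
    have e3 : i + r = i' + r' := e1.symm.trans e2
    have hr := hR r (Finset.mem_product.1 ha).1
    have hr' := hR r' (Finset.mem_product.1 ha').1
    by_cases hrr : r = r'
    · subst hrr
      exact hne (by rw [Nat.add_right_cancel e3])
    · refine disj r hr r' hr' hrr _ hx ?_
      have hx'' : T (-(((i' + r' : ℕ) : ℝ) * s)) x ∈ gapSet T s h p r' := hx'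
      simpa only [e3] using hx''
  have h1 := setIntegral_biUnion_of_eqOn_const (ν := μ)
    (F := fun x => |c (p (T ((h + r₀ : ℕ) * s) x)) - c (p x)|) (P := P)
    (H := fun a => |c (a.2 + r₀) - c (a.2 + a.1)|) S hPm hPd fun a ha x hx => by
      rw [(hpos a ha x hx).1, (hpos a ha x hx).2]
  set G := ⋃ a ∈ S, P a with hG
  have hGm : MeasurableSet G := Finset.measurableSet_biUnion _ hPm
  have hGμ : μ.real G = (h - 2 * m : ℕ) * ∑ r ∈ R, μ.real (gapSet T s h p r) := by
    rw [hG, measureReal_biUnion_finset hPd hPm, hS, Finset.sum_product]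
    simp only [hPμ, Finset.sum_const, Finset.card_range, nsmul_eq_mul, Finset.mul_sum]
  have h2 : ∫ x in G, |c (p (T ((h + r₀ : ℕ) * s) x)) - c (p x)| ∂μ ≤
      μ.real {x | p x = 0} * b := by
    rw [h1, hS, Finset.sum_product]
    simp only [hPμ, ← Finset.mul_sum]
    calc _ ≤ ∑ r ∈ R, μ.real (gapSet T s h p r) * b := by
          refine Finset.sum_le_sum fun r hr => mul_le_mul_of_nonneg_left ?_ measureReal_nonneg
          simp only [abs_sub_comm (c (_ + r₀))]
          exact hRb r hr
      _ = (∑ r ∈ R, μ.real (gapSet T s h p r)) * b := by rw [Finset.sum_mul]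
      _ ≤ _ := mul_le_mul_of_nonneg_right hsum hb
  have i1 : Integrable (fun x => |c (p (T ((h + r₀ : ℕ) * s) x)) - c (p x)|) μ :=
    ((mp.integrable_comp_of_integrable (hp.integrable_comp hc)).sub (hp.integrable_comp hc)).abs
  have h3 : ∫ x in Gᶜ, |c (p (T ((h + r₀ : ℕ) * s) x)) - c (p x)| ∂μ ≤
      1 - (h - 2 * m : ℕ) * ∑ r ∈ R, μ.real (gapSet T s h p r) := by
    rw [← hGμ, ← probReal_compl_eq_one_sub hGm]
    have := integral_mono (μ := μ.restrict Gᶜ) i1.integrableOn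
      (integrable_const (1 : ℝ)) fun x => abs_sub_le_one_of_mem_Icc (hc _) (hc _)
    simpa using this
  have h4 := integral_add_compl hGm i1
  have h5 := integral_abs_sub_le_of_coupling mp (MeasurePreserving.id μ) hu
    (hp.integrable_comp hc)
  simp only [id] at h5
  rw [displacement]
  linarith

open Classical in
/-- A tower for which most pairs of a self-joining are typical has a gap `r` such that the time
`h + r` hardly moves `u`. -/
lemma IsTowerPosition.exists_displacement_le [IsProbabilityMeasure μ]
    [IsProbabilityMeasure ν] (hT : IsFlow μ T) (hp : IsTowerPosition T s h p)
    (hν : IsSelfJoining T μ ν) {c : ℕ → ℝ} (hc : ∀ i, c i ∈ Set.Icc (0 : ℝ) 1) {u : X → ℝ}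
    (hu : Integrable u μ) {ℓ θ κ : ℝ} (hθ : 0 ≤ θ) {m n : ℕ} (hm : 0 < m) (hmh : 2 * m ≤ h)
    (hℓ : (3 * m : ℝ) ≤ ℓ) (hn : (h : ℝ) ≤ n * ℓ)
    (hκ : ν.real (typicalPairs p h c ℓ θ)ᶜ ≤ κ) (hκm : 2 * κ < m * μ.real {x | p x = 0}) :
    ∃ r : ℕ, displacement μ T u ((h + r : ℕ) * s) ≤ 2 * ∫ x, |u x - c (p x)| ∂μ +
      μ.real {x | p x = 0} * (n * (6 * θ + 4 * m)) +
      (1 - (h - 2 * m : ℕ) * (μ.real {x | p x = 0} - 2 * κ / m)) := by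
  have key := hp.measure_base_le_sum_gapSet hT hν (by omega) hℓ hκ
  set R : Finset ℕ := {r ∈ Finset.range (2 * m) | IsAdmissibleGap c h ℓ θ r} with hR
  have hm' : (0 : ℝ) < m := by exact_mod_cast hm
  have hne : R.Nonempty := by
    by_contra hemp
    rw [Finset.not_nonempty_iff_eq_empty.1 hemp] at key
    simp at key
    linarith
  have hRm : ∀ r ∈ R, r < 2 * m ∧ IsAdmissibleGap c h ℓ θ r := fun r hr => by
    have := Finset.mem_filter.1 hr
    exact ⟨Finset.mem_range.1 this.1, this.2⟩
  obtain ⟨r₀, hr₀⟩ := hne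
  refine ⟨r₀, (hp.displacement_le_of_gaps hT hc hu hmh (fun r hr => (hRm r hr).1) (hRm r₀ hr₀).1
    (b := n * (6 * θ + 4 * m)) (by positivity) ?_).trans ?_⟩
  · intro r hr
    have l1 := (hRm r hr).1
    have l2 := (hRm r₀ hr₀).1
    refine ((hRm r hr).2.sum_le (fun i j => abs_sub_le_one_of_mem_Icc (hc i) (hc j))
      (hRm r₀ hr₀).2 hn (by omega) (by omega)).trans ?_
    refine mul_le_mul_of_nonneg_left ?_ (Nat.cast_nonneg _)
    have : (r : ℝ) ≤ 2 * m := by exact_mod_cast l1.le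
    have : (r₀ : ℝ) ≤ 2 * m := by exact_mod_cast l2.le
    linarith
  · have : μ.real {x | p x = 0} - 2 * κ / m ≤ ∑ r ∈ R, μ.real (gapSet T s h p r) := by
      rw [sub_le_iff_le_add, ← sub_le_iff_le_add', le_div_iff₀ hm']
      linarith
    have := mul_le_mul_of_nonneg_left this (Nat.cast_nonneg (α := ℝ) (h - 2 * m))
    linarith

end SingleTower

/-! ### Subadditivity of the displacement -/

section Displacement

variable {X : Type*} [MeasurableSpace X] {μ : Measure X} {T : ℝ → X → X}

lemma displacement_neg (hT : IsFlow μ T) {u : X → ℝ} (hu : Integrable u μ) (t : ℝ) :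
    displacement μ T u (-t) = displacement μ T u t := by
  have mp := hT.measurePreserving t
  have hi : Integrable (fun x => |u (T (-t) x) - u x|) μ :=
    (((hT.measurePreserving (-t)).integrable_comp_of_integrable hu).sub hu).abs
  rw [displacement, ← mp.map_eq, integral_map mp.aemeasurable
    (by rw [mp.map_eq]; exact hi.aestronglyMeasurable), mp.map_eq, displacement]
  simp only [← hT.map_add, neg_add_cancel, hT.map_zero]
  simp only [abs_sub_comm]

lemma displacement_add_le (hT : IsFlow μ T) {u : X → ℝ} (hu : Integrable u μ) (a b : ℝ) :
    displacement μ T u (a + b) ≤ displacement μ T u a + displacement μ T u b := by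
  have mp := hT.measurePreserving b
  have hi : ∀ t, Integrable (fun x => |u (T t x) - u x|) μ := fun t =>
    (((hT.measurePreserving t).integrable_comp_of_integrable hu).sub hu).abs
  have e : displacement μ T u a = ∫ x, |u (T (a + b) x) - u (T b x)| ∂μ := by
    rw [displacement]
    conv_lhs => rw [← mp.map_eq]
    rw [integral_map mp.aemeasurable (by rw [mp.map_eq]; exact (hi a).aestronglyMeasurable)]
    simp only [hT.map_add]
  have hi2 : Integrable (fun x => |u (T (a + b) x) - u (T b x)|) μ :=
    (((hT.measurePreserving _).integrable_comp_of_integrable hu).sub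
      (mp.integrable_comp_of_integrable hu)).abs
  rw [e, displacement, displacement, ← integral_add hi2 (hi b)]
  exact integral_mono (hi _) (hi2.add (hi b)) fun x => abs_sub_le _ _ _

lemma displacement_zero (hT : IsFlow μ T) (u : X → ℝ) : displacement μ T u 0 = 0 := by
  simp [displacement, hT.map_zero]

lemma displacement_nat_mul_le (hT : IsFlow μ T) {u : X → ℝ} (hu : Integrable u μ) (n : ℕ) (t : ℝ) :
    displacement μ T u (n * t) ≤ n * displacement μ T u t := by
  induction n with
  | zero => simp [displacement_zero hT]
  | succ n ih =>
    have := displacement_add_le hT hu (n * t) t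
    rw [Nat.cast_succ, add_mul, one_mul]
    linarith

/-- If long times displace `u` by a definite amount, then so do all times bounded away from `0`,
because of subadditivity. -/
lemma exists_pos_le_displacement (hT : IsFlow μ T) {u : X → ℝ} (hu : Integrable u μ) {ε L : ℝ}
    (hε : 0 < ε) (hL : ∀ t, L ≤ t → ε ≤ displacement μ T u t) {τ : ℝ} (hτ : 0 < τ) :
    ∃ φ > 0, ∀ t, τ ≤ t → φ ≤ displacement μ T u t := by
  obtain ⟨n, hn⟩ := exists_nat_gt (L / τ)
  have hn' : L ≤ (n + 1 : ℕ) * τ := by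
    rw [div_lt_iff₀ hτ] at hn
    push_cast
    linarith
  refine ⟨ε / (n + 1 : ℕ), by positivity, fun t ht => ?_⟩
  rw [div_le_iff₀ (by positivity), mul_comm]
  exact (hL _ (hn'.trans (mul_le_mul_of_nonneg_left ht (by positivity)))).trans
    (displacement_nat_mul_le hT hu _ _)

end Displacement

/-! ### Long times with small displacement -/

section Core

variable {X : Type*} [MeasurableSpace X] {μ : Measure X} {T : ℝ → X → X} {ν : Measure (X × X)}

open Classical in
/-- The atypical diagonals have small mass: those that are not approximate periods of the word `c`
because `f` takes equal values at both points, the short ones because `g` separates the points. -/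
lemma IsTowerPosition.measureReal_ascendingPairs_atypical_le [IsProbabilityMeasure μ]
    [IsProbabilityMeasure ν] {s : ℝ} {h : ℕ} {p : X → ℕ} (hp : IsTowerPosition T s h p)
    (hν : IsSelfJoining T μ ν)
    {c c' : ℕ → ℝ} (hc : ∀ i, c i ∈ Set.Icc (0 : ℝ) 1) (hc' : ∀ i, c' i ∈ Set.Icc (0 : ℝ) 1)
    {f g : X → ℝ} (hf : Integrable f μ) (hfν : ∀ᵐ z ∂ν, f z.1 = f z.2)
    (hg : Measurable g) (hgi : Integrable g μ) {θ ω σ ℓ : ℝ} (hθ : 0 < θ) (hω : 0 ≤ ω)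
    (hσ : 0 < σ)
    (hshort : ∀ k < h, (k : ℝ) < ℓ → shiftDefect c h k ≤ θ * h →
      2 * k ≤ h ∧ shiftDefect c' h k ≤ ω * h) :
    ν.real (ascendingPairs p h
      {k ∈ Finset.range h | ¬ (ℓ ≤ k ∧ shiftDefect c h k ≤ θ * h)}) ≤
      2 * (∫ x, |f x - c (p x)| ∂μ) / θ + (ν.real {z | |g z.1 - g z.2| < σ} +
        (2 * ω + 2 * ∫ x, |g x - c' (p x)| ∂μ) / σ) := by
  have h1 := hp.measureReal_ascendingPairs_le_of_defect hν hc hf hfν hθ.le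
    (K := {k ∈ Finset.range h | θ * h < shiftDefect c h k})
    (fun k hk => Finset.mem_range.1 (Finset.mem_filter.1 hk).1)
    (fun k hk => (Finset.mem_filter.1 hk).2.le)
  have h2 := hp.measureReal_ascendingPairs_le_of_short hν hc' hg hgi hω hσ.le
    (K := {k ∈ Finset.range h | (k : ℝ) < ℓ ∧ shiftDefect c h k ≤ θ * h})
    (fun k hk => Finset.mem_range.1 (Finset.mem_filter.1 hk).1)
    (fun k hk => (hshort k (Finset.mem_range.1 (Finset.mem_filter.1 hk).1)
      (Finset.mem_filter.1 hk).2.1 (Finset.mem_filter.1 hk).2.2).1)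
    (fun k hk => (hshort k (Finset.mem_range.1 (Finset.mem_filter.1 hk).1)
      (Finset.mem_filter.1 hk).2.1 (Finset.mem_filter.1 hk).2.2).2)
  have hsub : ascendingPairs p h {k ∈ Finset.range h | ¬ (ℓ ≤ k ∧ shiftDefect c h k ≤ θ * h)} ⊆
      ascendingPairs p h {k ∈ Finset.range h | θ * h < shiftDefect c h k} ∪
      ascendingPairs p h {k ∈ Finset.range h | (k : ℝ) < ℓ ∧ shiftDefect c h k ≤ θ * h} := by
    rintro z ⟨z1, z2, z3⟩
    obtain ⟨z4, z5⟩ := Finset.mem_filter.1 z3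
    by_cases hd : shiftDefect c h (p z.2 - p z.1) ≤ θ * h
    · refine Or.inr ⟨z1, z2, Finset.mem_filter.2 ⟨z4, ?_, hd⟩⟩
      by_contra hl
      exact z5 ⟨not_lt.1 hl, hd⟩
    · exact Or.inl ⟨z1, z2, Finset.mem_filter.2 ⟨z4, not_le.1 hd⟩⟩
  refine ((measureReal_mono hsub).trans (measureReal_union_le _ _)).trans (add_le_add ?_ ?_)
  · rw [le_div_iff₀ hθ, mul_comm]; exact h1
  · rw [← sub_le_iff_le_add', le_div_iff₀ hσ]
    linarith

/-- Under a self-joining that does not charge the diagonal, the values of a function separating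
points are rarely close. -/
lemma exists_measureReal_abs_sub_lt_le [IsProbabilityMeasure ν] {g : X → ℝ} (hg : Measurable g)
    (hgν : ∀ᵐ z ∂ν, g z.1 ≠ g z.2) {κ : ℝ} (hκ : 0 < κ) :
    ∃ σ > 0, ν.real {z | |g z.1 - g z.2| < σ} ≤ κ := by
  set a : ℕ → ℝ := fun n => 1 / ((n : ℝ) + 1) with ha
  set A : ℕ → Set (X × X) := fun n => {z | |g z.1 - g z.2| < a n} with hA
  have hgm : Measurable fun z : X × X => |g z.1 - g z.2| :=
    ((hg.comp measurable_fst).sub (hg.comp measurable_snd)).abs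
  have hanti : Antitone A := fun m n hmn z hz =>
    lt_of_lt_of_le (b := a n) hz (Nat.one_div_le_one_div hmn)
  have hlim := tendsto_measure_iInter_atTop (μ := ν) (s := A)
    (fun n => (measurableSet_lt hgm measurable_const).nullMeasurableSet) hanti
    ⟨0, measure_ne_top _ _⟩
  have hzero : ν (⋂ n, A n) = 0 := by
    refine measure_mono_null (fun z hz => ?_) hgν
    intro hne
    have hpos : 0 < |g z.1 - g z.2| := abs_pos.2 (sub_ne_zero.2 hne)
    obtain ⟨n, hn⟩ := exists_nat_one_div_lt hpos
    exact lt_asymm hn (Set.mem_iInter.1 hz n)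
  rw [hzero] at hlim
  have hlim' := (ENNReal.tendsto_toReal ENNReal.zero_ne_top).comp hlim
  obtain ⟨n, hn⟩ := (hlim'.eventually (gt_mem_nhds (show (0 : ENNReal).toReal < κ by simpa))).exists
  exact ⟨a n, by positivity, hn.le⟩

lemma IsTowerPosition.height_mul_measureReal_base [IsProbabilityMeasure μ] (hT : IsFlow μ T)
    {s : ℝ} {h : ℕ} {p : X → ℕ} (hp : IsTowerPosition T s h p) :
    h * μ.real {x | p x = 0} = 1 - μ.real {x | ¬ p x < h} := by
  have h1 := hp.measureReal_lt hT (le_refl h)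
  have h2 : μ.real {x | ¬ p x < h} = 1 - μ.real {x | p x < h} :=
    probReal_compl_eq_one_sub (hp.measurable (measurableSet_Iio (a := h)))
  rw [h2, h1]; ring

/-- If long times move `f` by at least `ε`, then an approximate period of its word that is short in
comparison with the height of the tower corresponds to a time at most `L`, hence is negligible in
comparison with the height, and then corresponds to a time at most `τ`. Such a time hardly moves
the given function `g`. -/
lemma IsTowerPosition.shiftDefect_le_of_short_period [IsProbabilityMeasure μ] (hT : IsFlow μ T)
    {s : ℝ} {h : ℕ} {p : X → ℕ} (hp : IsTowerPosition T s h p) (hs : 0 < s)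
    {c c' : ℕ → ℝ} (hc : ∀ i, c i ∈ Set.Icc (0 : ℝ) 1) (hc' : ∀ i, c' i ∈ Set.Icc (0 : ℝ) 1)
    {f g : X → ℝ} (hf : Integrable f μ) (hg : Integrable g μ) {δ ε L τ φ γ η η' θ ρ : ℝ}
    (hρ : μ.real {x | ¬ p x < h} ≤ ρ) (hρ' : ρ ≤ 1 / 2) (hη : ∫ x, |f x - c (p x)| ∂μ ≤ η)
    (hη' : ∫ x, |g x - c' (p x)| ∂μ ≤ η') (hθ : 0 ≤ θ) (hδ0 : 0 ≤ δ) (hδ : δ ≤ 1 / 2)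
    (hL : ∀ t, L ≤ t → ε ≤ displacement μ T f t)
    (hτ : ∀ t, τ ≤ t → φ ≤ displacement μ T f t) (hγ : ∀ t, |t| < τ → displacement μ T g t < γ)
    (hε' : θ + 2 * η + ρ + δ < ε) (hφ : θ + 2 * η + ρ + φ / 8 < φ)
    (hlen : 8 * L ≤ φ * (s * h)) (hsh : 0 < s * h) {k : ℕ} (hk : k < h) (hkδ : (k : ℝ) < δ * h)
    (hkθ : shiftDefect c h k ≤ θ * h) :
    2 * k ≤ h ∧ shiftDefect c' h k ≤ 2 * (γ + 2 * η') * h := by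
  have heH := hp.height_mul_measureReal_base hT
  have d1 := hp.displacement_le hT hc hf k
  rw [Nat.cast_sub hk.le] at d1
  have d3 := hp.measure_mul_shiftDefect_le hT hc' hg k
  have d6 := shiftDefect_nonneg c' h k
  have he0 : 0 ≤ μ.real {x | p x = 0} := measureReal_nonneg
  have hρ0 : 0 ≤ μ.real {x | ¬ p x < h} := measureReal_nonneg
  have hk0 : (0 : ℝ) ≤ k := Nat.cast_nonneg k
  have hH0 : (0 : ℝ) ≤ h := Nat.cast_nonneg h
  have hkh : 2 * (k : ℝ) ≤ h := by nlinarith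
  refine ⟨by exact_mod_cast hkh, ?_⟩
  have hks : 0 ≤ (k : ℝ) * s := by positivity
  have hγ' := hγ (k * s)
  rw [abs_of_nonneg hks] at hγ'
  have hL' := hL (k * s)
  have hτ' := hτ (k * s)
  generalize displacement μ T f (k * s) = F at *
  generalize displacement μ T g (k * s) = G at *
  generalize μ.real {x | p x = 0} = e at *
  generalize μ.real {x | ¬ p x < h} = ρ₁ at *
  generalize shiftDefect c h k = D at *
  generalize shiftDefect c' h k = D' at *
  generalize (h : ℝ) = H at *
  generalize (k : ℝ) = k at *
  clear hL hτ hγ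
  have heH1 : H * e ≤ 1 := by linarith
  have heH2 : 1 / 2 ≤ H * e := by linarith
  have d2 : F ≤ θ + 2 * η + ρ + k * e := by
    have a1 : e * D ≤ e * (θ * H) := mul_le_mul_of_nonneg_left hkθ he0
    have a2 : θ * (H * e) ≤ θ * 1 := mul_le_mul_of_nonneg_left heH1 hθ
    have a3 : e * (θ * H) = θ * (H * e) := by ring
    have a4 : (H - k) * e = H * e - k * e := by ring
    linarith
  have hke : k * e ≤ δ := by
    have a1 : k * e ≤ δ * H * e := mul_le_mul_of_nonneg_right hkδ.le he0
    have a2 : δ * (H * e) ≤ δ * 1 := mul_le_mul_of_nonneg_left heH1 hδ0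
    linarith
  have hkL : k * s < L := by
    by_contra hle
    linarith [hL' (not_lt.1 hle)]
  have hke' : k * e ≤ φ / 8 := by
    have h2 : (k * e) * (s * H) ≤ L := by
      have a1 : (k * e) * (s * H) = (k * s) * (H * e) := by ring
      have a2 : (k * s) * (H * e) ≤ (k * s) * 1 := mul_le_mul_of_nonneg_left heH1 hks
      linarith
    refine le_of_mul_le_mul_right ?_ hsh
    linarith
  have hkτ : k * s < τ := by
    by_contra hle
    linarith [hτ' (not_lt.1 hle)]
  have d4 := (hγ' hkτ).le
  have d5 : e * D' ≤ γ + 2 * η' := by linarith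
  calc D' = 2 * (1 / 2) * D' := by ring
    _ ≤ 2 * (H * e) * D' := by gcongr
    _ = 2 * H * (e * D') := by ring
    _ ≤ 2 * H * (γ + 2 * η') := by gcongr
    _ = _ := by ring

/-- The numerical form of `IsTowerPosition.exists_displacement_le`, the band of `m` levels at the
top having about the proportion `β` of the height of the tower. -/
lemma IsTowerPosition.exists_displacement_lt_of_typical [IsProbabilityMeasure μ]
    [IsProbabilityMeasure ν] (hT : IsFlow μ T) {s : ℝ} {h : ℕ} {p : X → ℕ}
    (hp : IsTowerPosition T s h p) (hν : IsSelfJoining T μ ν)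
    {c : ℕ → ℝ} (hc : ∀ i, c i ∈ Set.Icc (0 : ℝ) 1) {f : X → ℝ}
    (hf : Integrable f μ) {δ β ε θ : ℝ} {n : ℕ} (hε : 0 < ε) (hε1 : ε ≤ 1)
    (hρ : μ.real {x | ¬ p x < h} ≤ ε / 100) (hη : ∫ x, |f x - c (p x)| ∂μ ≤ ε / 100)
    (hθ : 0 ≤ θ) (hn : 1 ≤ n * δ) (hβ : 0 < β) (hβδ : 3 * β ≤ δ) (hδ1 : δ ≤ 1 / 2)
    (hnβ : n * β ≤ ε / 100) (hβε : β ≤ ε / 60) (hnθ : n * θ ≤ ε / 100) (hβh : 2 ≤ β * h)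
    (htyp : ν.real (typicalPairs p h c (δ * h) (θ * h))ᶜ ≤ β * ε / 100) :
    ∃ r : ℕ, displacement μ T f ((h + r : ℕ) * s) < ε := by
  have heH := hp.height_mul_measureReal_base hT
  have he0 : 0 ≤ μ.real {x | p x = 0} := measureReal_nonneg
  have hρ0 : 0 ≤ μ.real {x | ¬ p x < h} := measureReal_nonneg
  have heH1 : h * μ.real {x | p x = 0} ≤ 1 := by linarith
  have heH2 : 1 / 2 ≤ h * μ.real {x | p x = 0} := by linarith
  have hH0 : (0 : ℝ) ≤ h := Nat.cast_nonneg h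
  obtain ⟨m, hm1, hm2⟩ : ∃ m : ℕ, (m : ℝ) ≤ β * h ∧ β * h / 2 ≤ m := by
    refine ⟨⌊β * h⌋₊, Nat.floor_le (by positivity), ?_⟩
    have := Nat.lt_floor_add_one (β * h)
    linarith
  have hm0 : (0 : ℝ) < m := by linarith
  have hδh : 3 * (β * h) ≤ δ * h := by nlinarith
  have hδh' : δ * h ≤ 1 / 2 * h := mul_le_mul_of_nonneg_right hδ1 hH0
  have h2m : 2 * m ≤ h := by
    have : (2 * m : ℝ) ≤ h := by linarith
    exact_mod_cast this
  have hme : β / 4 ≤ m * μ.real {x | p x = 0} := by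
    have a1 := mul_le_mul_of_nonneg_right hm2 he0
    have a2 := mul_le_mul_of_nonneg_left heH2 hβ.le
    linarith
  have hme' : m * μ.real {x | p x = 0} ≤ β := by
    have a1 := mul_le_mul_of_nonneg_right hm1 he0
    have a2 := mul_le_mul_of_nonneg_left heH1 hβ.le
    linarith
  have hβε1 : β * ε ≤ β * 1 := mul_le_mul_of_nonneg_left hε1 hβ.le
  obtain ⟨r, hr⟩ := hp.exists_displacement_le hT hν hc hf (n := n) (m := m)
    (by positivity) (by exact_mod_cast hm0) h2m (by linarith)
    (by
      have := mul_le_mul_of_nonneg_right hn hH0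
      linarith) htyp (by linarith)
  refine ⟨r, lt_of_le_of_lt hr ?_⟩
  rw [Nat.cast_sub h2m]
  push_cast
  clear hr htyp h2m
  generalize μ.real {x | p x = 0} = e at *
  generalize μ.real {x | ¬ p x < h} = ρ₁ at *
  generalize (h : ℝ) = H at *
  generalize (m : ℝ) = m at *
  generalize (n : ℝ) = n at *
  have t1 : e * (n * (6 * (θ * H) + 4 * m)) ≤ 10 * ε / 100 := by
    have hn0 : 0 ≤ n := by
      by_contra hneg
      nlinarith
    have a1 : e * (n * (6 * (θ * H) + 4 * m)) = 6 * (n * θ) * (H * e) + 4 * n * (m * e) := by ring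
    have a2 : 6 * (n * θ) * (H * e) ≤ 6 * (n * θ) :=
      mul_le_of_le_one_right (by positivity) heH1
    have a3 : 4 * n * (m * e) ≤ 4 * n * β := mul_le_mul_of_nonneg_left hme' (by positivity)
    linarith
  have t2 : 2 * (β * ε / 100) / m * H ≤ 4 * ε / 100 := by
    rw [div_mul_eq_mul_div, div_le_iff₀ hm0]
    have a1 : 2 * (β * ε / 100) * H = (4 * ε / 100) * (β * H / 2) := by ring
    rw [a1]
    exact mul_le_mul_of_nonneg_left hm2 (by positivity)
  have t3 : 1 - (H - 2 * m) * (e - 2 * (β * ε / 100) / m) ≤ 3 * ε / 60 + 4 * ε / 100 := by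
    have a1 : (H - 2 * m) * (e - 2 * (β * ε / 100) / m) =
        H * e - 2 * (m * e) - 2 * (β * ε / 100) / m * H + 4 * (β * ε / 100) * (m / m) := by ring
    have a2 : 0 ≤ β * ε := by positivity
    rw [a1, div_self hm0.ne', heH]
    linarith
  linarith

/-- The heart of the matter: if a self-joining of a rank-one flow does not charge the diagonal, then
every function `f` whose values at the two points of the joining agree is almost preserved by
arbitrarily long times. -/
theorem exists_displacement_lt [IsProbabilityMeasure μ] [IsProbabilityMeasure ν]
    (hT : IsFlow μ T) {s : ℕ → ℝ} {h : ℕ → ℕ} {p : ℕ → X → ℕ} (hs : ∀ j, 0 < s j)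
    (hs0 : Tendsto s atTop (𝓝 0)) (hsh : Tendsto (fun j => s j * h j) atTop atTop)
    (hp : ∀ j, IsTowerPosition T (s j) (h j) (p j))
    (hcover : Tendsto (fun j => μ.real {x | ¬ p j x < h j}) atTop (𝓝 0))
    (happrox : ∀ u : X → ℝ, Measurable u → (∀ x, u x ∈ Set.Icc (0 : ℝ) 1) → ∀ η > 0,
      ∀ᶠ j in atTop, ∃ c : ℕ → ℝ, (∀ i, c i ∈ Set.Icc (0 : ℝ) 1) ∧
        ∫ x, |u x - c (p j x)| ∂μ ≤ η)
    (hν : IsSelfJoining T μ ν) {f g : X → ℝ}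
    (hf : Measurable f) (hf01 : ∀ x, f x ∈ Set.Icc (0 : ℝ) 1) (hfν : ∀ᵐ z ∂ν, f z.1 = f z.2)
    (hg : Measurable g) (hg01 : ∀ x, g x ∈ Set.Icc (0 : ℝ) 1) (hgν : ∀ᵐ z ∂ν, g z.1 ≠ g z.2)
    (hgcont : Tendsto (displacement μ T g) (𝓝 0) (𝓝 0)) {ε : ℝ} (hε : 0 < ε) (L : ℝ) :
    ∃ t, L ≤ t ∧ displacement μ T f t < ε := by
  classical
  by_contra! hcon
  have hfi : Integrable f μ := integrable_of_measurable_of_mem_Icc hf hf01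
  have hgi : Integrable g μ := integrable_of_measurable_of_mem_Icc hg hg01
  -- It may be assumed that `ε ≤ 1 ≤ L`.
  wlog hεL : ε ≤ 1 ∧ 1 ≤ L generalizing ε L
  · exact this (lt_min hε one_pos) (max L 1)
      (fun t ht => (min_le_left _ _).trans (hcon t ((le_max_left _ _).trans ht)))
      ⟨min_le_right _ _, le_max_right _ _⟩
  obtain ⟨hε1, hL1⟩ := hεL
  -- The order of the choices: `δ`, `n`, `β`, `κ`, then `σ`, `γ`, `τ`, `φ`, then `θ`, `η`, `ρ`,
  -- and finally the tower.
  obtain ⟨δ, hδ⟩ : ∃ δ : ℝ, δ = ε / 20 := ⟨_, rfl⟩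
  have hδ0 : 0 < δ := by linarith
  obtain ⟨n, hn⟩ := exists_nat_gt (1 / δ)
  have hn0 : (0 : ℝ) < n := (by positivity : 0 < 1 / δ).trans hn
  have hn1 : (1 : ℝ) ≤ n := by
    have : 0 < n := by exact_mod_cast hn0
    exact_mod_cast this
  have hnδ : 1 ≤ n * δ := by
    rw [div_lt_iff₀ hδ0] at hn; exact hn.le
  have hdiv : n * (ε / (100 * n)) = ε / 100 := by field_simp
  obtain ⟨β, hβ0, hβ1, hβδ⟩ : ∃ β > 0, β ≤ ε / (100 * n) ∧ β ≤ δ / 3 :=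
    ⟨min (ε / (100 * n)) (δ / 3), by positivity, min_le_left _ _, min_le_right _ _⟩
  have hβn : n * β ≤ ε / 100 := hdiv ▸ mul_le_mul_of_nonneg_left hβ1 hn0.le
  obtain ⟨κ, hκ⟩ : ∃ κ : ℝ, κ = β * ε / 100 := ⟨_, rfl⟩
  have hκ0 : 0 < κ := by rw [hκ]; positivity
  obtain ⟨σ, hσ0, hσ⟩ := exists_measureReal_abs_sub_lt_le hg hgν (show 0 < κ / 8 by positivity)
  obtain ⟨γ, hγ⟩ : ∃ γ : ℝ, γ = σ * κ / 64 := ⟨_, rfl⟩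
  have hγ0 : 0 < γ := by rw [hγ]; positivity
  obtain ⟨ηg, hηg⟩ : ∃ η : ℝ, η = σ * κ / 160 := ⟨_, rfl⟩
  have hηg0 : 0 < ηg := by rw [hηg]; positivity
  obtain ⟨τ, hτ0, hτ⟩ : ∃ τ > 0, ∀ t, |t| < τ → displacement μ T g t < γ := by
    obtain ⟨τ, hτ0, hτ⟩ := Metric.eventually_nhds_iff.1 (hgcont.eventually (gt_mem_nhds hγ0))
    exact ⟨τ, hτ0, fun t ht => hτ (by simpa using ht)⟩
  obtain ⟨φ, hφ0, hφ⟩ := exists_pos_le_displacement hT hfi hε hcon hτ0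
  obtain ⟨θ, hθ0, hθ1, hθφ⟩ : ∃ θ > 0, θ ≤ ε / (100 * n) ∧ θ ≤ φ / 8 :=
    ⟨min (ε / (100 * n)) (φ / 8), by positivity, min_le_left _ _, min_le_right _ _⟩
  have hθn : n * θ ≤ ε / 100 := hdiv ▸ mul_le_mul_of_nonneg_left hθ1 hn0.le
  have hθε : θ ≤ ε / 100 := (le_mul_of_one_le_left hθ0.le hn1).trans hθn
  obtain ⟨η, hη0, hηθ, hηφ, hηε⟩ : ∃ η > 0, η ≤ θ * κ / 16 ∧ η ≤ φ / 16 ∧ η ≤ ε / 100 :=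
    ⟨min (θ * κ / 16) (min (φ / 16) (ε / 100)), by positivity, min_le_left _ _,
      (min_le_right _ _).trans (min_le_left _ _), (min_le_right _ _).trans (min_le_right _ _)⟩
  obtain ⟨ρ, hρ0, hρκ, hρφ, hρε⟩ : ∃ ρ > 0, ρ ≤ κ / 8 ∧ ρ ≤ φ / 8 ∧ ρ ≤ ε / 100 :=
    ⟨min (κ / 8) (min (φ / 8) (ε / 100)), by positivity, min_le_left _ _,
      (min_le_right _ _).trans (min_le_left _ _), (min_le_right _ _).trans (min_le_right _ _)⟩
  obtain ⟨j, ⟨c, hc, hcη⟩, ⟨c', hc', hcη'⟩, hρj, hlen, hs1, hlen'⟩ :=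
    ((happrox f hf hf01 η hη0).and ((happrox g hg hg01 ηg hηg0).and
      ((hcover.eventually (gt_mem_nhds hρ0)).and ((hsh.eventually_ge_atTop (max L (8 * L / φ))).and
        ((hs0.eventually (gt_mem_nhds (zero_lt_one' ℝ))).and
          (hsh.eventually_ge_atTop (2 / β))))))).exists
  have hβH : 2 ≤ β * h j := by
    have a1 : 2 / β ≤ h j := hlen'.trans (mul_le_of_le_one_left (Nat.cast_nonneg _) hs1.le)
    rw [div_le_iff₀ hβ0] at a1
    linarith
  have hL8 : 8 * L ≤ φ * (s j * h j) := by
    have a1 := (le_max_right _ _).trans hlen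
    rw [div_le_iff₀ hφ0] at a1
    linarith
  have hlenL := (le_max_left _ _).trans hlen
  have hshort : ∀ k < h j, (k : ℝ) < δ * h j → shiftDefect c (h j) k ≤ θ * h j →
      2 * k ≤ h j ∧ shiftDefect c' (h j) k ≤ 2 * (γ + 2 * ηg) * h j := fun k hk hkδ hkθ =>
    (hp j).shiftDefect_le_of_short_period hT (hs j) hc hc' hfi hgi hρj.le (by linarith) hcη hcη'
      hθ0.le hδ0.le (by linarith) hcon hφ hτ (by linarith) (by linarith) hL8
      (by linarith) hk hkδ hkθ
  have hbound : ∀ q : ℝ, q ≤ κ / 8 → 2 * (∫ x, |f x - c (p j x)| ∂μ) / θ + (q +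
        (2 * (2 * (γ + 2 * ηg)) + 2 * ∫ x, |g x - c' (p j x)| ∂μ) / σ) ≤ 3 * κ / 8 := by
    intro q hq
    have b1 : 2 * (∫ x, |f x - c (p j x)| ∂μ) / θ ≤ κ / 8 := by
      rw [div_le_iff₀ hθ0]; linarith
    have b2 : (2 * (2 * (γ + 2 * ηg)) + 2 * ∫ x, |g x - c' (p j x)| ∂μ) / σ ≤ κ / 8 := by
      rw [div_le_iff₀ hσ0]; linarith
    linarith
  have hswapm : Measurable (Prod.swap : X × X → X × X) := measurable_swap
  have : IsProbabilityMeasure (ν.map Prod.swap) :=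
    Measure.isProbabilityMeasure_map hswapm.aemeasurable
  have hfm : MeasurableSet {z : X × X | f z.1 = f z.2} :=
    measurableSet_eq_fun (hf.comp measurable_fst) (hf.comp measurable_snd)
  have hfν' : ∀ᵐ z ∂(ν.map Prod.swap), f z.1 = f z.2 := by
    rw [ae_map_iff hswapm.aemeasurable hfm]
    filter_upwards [hfν] with z hz using hz.symm
  have hσ' : (ν.map Prod.swap).real {z | |g z.1 - g z.2| < σ} ≤ κ / 8 := by
    have hgm : Measurable fun z : X × X => |g z.1 - g z.2| :=
      ((hg.comp measurable_fst).sub (hg.comp measurable_snd)).abs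
    rw [map_measureReal_apply hswapm (measurableSet_lt hgm measurable_const)]
    refine le_trans (le_of_eq ?_) hσ
    congr 1
    ext z
    simp [abs_sub_comm]
  have hω0 : 0 ≤ 2 * (γ + 2 * ηg) := by positivity
  have hup := ((hp j).measureReal_ascendingPairs_atypical_le hν hc hc' hfi hfν hg hgi hθ0 hω0 hσ0
    hshort).trans (hbound _ hσ)
  have hdown := ((hp j).measureReal_ascendingPairs_atypical_le hν.swap hc hc' hfi hfν' hg hgi hθ0
    hω0 hσ0 hshort).trans (hbound _ hσ')
  have htyp := (hp j).measureReal_compl_typicalPairs_le hν hup hdown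
  obtain ⟨r, hr⟩ := (hp j).exists_displacement_lt_of_typical hT hν hc hfi hε hε1
    (hρj.le.trans hρε) (hcη.trans hηε) hθ0.le hnδ hβ0 (by linarith) (by linarith) hβn
    (by linarith) hθn hβH (htyp.trans (by linarith))
  have hbig : L ≤ (h j + r : ℕ) * s j := by
    refine hlenL.trans ?_
    rw [Nat.cast_add, mul_comm]
    exact mul_le_mul_of_nonneg_right (by linarith [Nat.cast_nonneg (α := ℝ) r]) (hs j).le
  exact absurd hr (not_lt.2 (hcon _ hbig))

end Core

/-! ### Continuity of the flow in `L¹` -/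

section Continuity

variable {X : Type*} [MeasurableSpace X] {μ : Measure X} {T : ℝ → X → X}

/-- Continuity of the flow in `L¹`. Countably many balls cover the separable orbit of `u`, so that
some ball is visited during a set of times of positive measure; by Steinhaus' theorem the
differences of such times form a neighbourhood of `0`. -/
lemma tendsto_displacement_zero [MeasurableSpace.CountablyGenerated X] [IsFiniteMeasure μ]
    (hT : IsFlow μ T) {u : X → ℝ} (hu : Measurable u) (hui : Integrable u μ) :
    Tendsto (displacement μ T u) (𝓝 0) (𝓝 0) := by
  have : Fact ((1 : ENNReal) ≤ 1) := ⟨le_rfl⟩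
  have : Fact ((1 : ENNReal) ≠ ⊤) := ⟨ENNReal.one_ne_top⟩
  have hti : ∀ t, Integrable (fun x => u (T t x)) μ := fun t =>
    (hT.measurePreserving t).integrable_comp_of_integrable hui
  rw [Metric.tendsto_nhds]
  intro ε hε
  set v : ℕ → Lp ℝ 1 μ := TopologicalSpace.denseSeq (Lp ℝ 1 μ) with hv
  set S : ℕ → Set ℝ := fun n => {t | ∫ x, |u (T t x) - v n x| ∂μ < ε / 2} with hS
  have hvi : ∀ n, Integrable (v n) μ := fun n => L1.integrable_coeFn (v n)
  have hSm : ∀ n, MeasurableSet (S n) := by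
    intro n
    have h1 : Measurable fun q : ℝ × X => |u (T q.1 q.2) - v n q.2| :=
      ((hu.comp hT.measurable_uncurry).sub
        ((Lp.stronglyMeasurable (v n)).measurable.comp measurable_snd)).abs
    have h2 : StronglyMeasurable fun t : ℝ => ∫ x, |u (T t x) - v n x| ∂μ :=
      h1.stronglyMeasurable.integral_prod_right
    exact measurableSet_lt h2.measurable measurable_const
  have hcover : ⋃ n, S n = Set.univ := by
    refine Set.eq_univ_of_forall fun t => Set.mem_iUnion.2 ?_
    obtain ⟨n, hn⟩ := (TopologicalSpace.denseRange_denseSeq (Lp ℝ 1 μ)).exists_dist_lt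
      ((hti t).toL1 _) (half_pos hε)
    refine ⟨n, ?_⟩
    rw [dist_eq_norm, L1.norm_eq_integral_norm] at hn
    refine lt_of_eq_of_lt (integral_congr_ae ?_) hn
    filter_upwards [Lp.coeFn_sub ((hti t).toL1 _) (v n), (hti t).coeFn_toL1] with x h1 h2
    change _ = ‖(((hti t).toL1 _ - v n : Lp ℝ 1 μ) : X → ℝ) x‖
    rw [h1, Pi.sub_apply, h2, Real.norm_eq_abs]
  obtain ⟨n, hn⟩ : ∃ n, 0 < volume (S n) := by
    by_contra! hcon
    have h1 := measure_iUnion_null fun n => le_antisymm (hcon n) zero_le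
    rw [hcover] at h1
    simp at h1
  have hnhds := Measure.sub_mem_nhds_zero_of_addHaar_pos volume (S n) (hSm n) hn
  filter_upwards [hnhds] with t ht
  obtain ⟨a, ha, b, hb, rfl⟩ := Set.mem_sub.1 ht
  rw [Real.dist_eq, sub_zero, abs_of_nonneg (displacement_nonneg _ _)]
  have mp := hT.measurePreserving b
  have hi : Integrable (fun x => |u (T (a - b) x) - u x|) μ := ((hti (a - b)).sub hui).abs
  have e : displacement μ T u (a - b) = ∫ x, |u (T a x) - u (T b x)| ∂μ := by
    rw [displacement]
    conv_lhs => rw [← mp.map_eq]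
    rw [integral_map mp.aemeasurable (by rw [mp.map_eq]; exact hi.aestronglyMeasurable)]
    simp only [← hT.map_add, sub_add_cancel]
  have ia : Integrable (fun x => |u (T a x) - v n x|) μ := ((hti a).sub (hvi n)).abs
  have ib : Integrable (fun x => |u (T b x) - v n x|) μ := ((hti b).sub (hvi n)).abs
  have iab : Integrable (fun x => |u (T a x) - u (T b x)|) μ := ((hti a).sub (hti b)).abs
  rw [e]
  calc ∫ x, |u (T a x) - u (T b x)| ∂μ
      ≤ ∫ x, (|u (T a x) - v n x| + |u (T b x) - v n x|) ∂μ := by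
        refine integral_mono iab (ia.add ib) fun x => ?_
        have h1 := abs_sub_le (u (T a x)) (v n x) (u (T b x))
        rw [abs_sub_comm (v n x)] at h1
        exact h1
    _ = _ := integral_add ia ib
    _ < ε / 2 + ε / 2 := add_lt_add ha hb
    _ = ε := add_halves ε

end Continuity

/-! ### The towers of a rank-one flow -/

section TowerPosition

variable {X : Type*} {T : ℝ → X → X}

open Classical in
/-- The number of the level containing a given point; the value is `h` outside of the tower. -/
noncomputable def towerPosition (T : ℝ → X → X) (s : ℝ) (h : ℕ) (E : Set X) (x : X) : ℕ :=
  if hx : ∃ i, i < h ∧ x ∈ towerLevel T s E i then Nat.find hx else h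

lemma towerPosition_eq_iff {s : ℝ} {h : ℕ} {E : Set X}
    (hd : ∀ i < h, ∀ l < h, i ≠ l → Disjoint (towerLevel T s E i) (towerLevel T s E l))
    {i : ℕ} (hi : i < h) (x : X) : towerPosition T s h E x = i ↔ x ∈ towerLevel T s E i := by
  classical
  unfold towerPosition
  constructor
  · intro hx
    split_ifs at hx with hex
    · exact hx ▸ (Nat.find_spec hex).2
    · omega
  · intro hx
    have hex : ∃ i, i < h ∧ x ∈ towerLevel T s E i := ⟨i, hi, hx⟩
    rw [dif_pos hex]
    by_contra hne
    have hsp := Nat.find_spec hex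
    exact Set.disjoint_left.1 (hd _ hsp.1 i hi hne) hsp.2 hx

lemma towerPosition_le (s : ℝ) (h : ℕ) (E : Set X) (x : X) : towerPosition T s h E x ≤ h := by
  classical
  unfold towerPosition
  split_ifs with hex
  · exact (Nat.find_spec hex).1.le
  · exact le_rfl

/-- The unions of elements of the partition are the sets described by the position in the tower. -/
lemma exists_preimage_towerPosition_eq {s : ℝ} {h : ℕ} {E : Set X}
    (hd : ∀ i < h, ∀ l < h, i ≠ l → Disjoint (towerLevel T s E i) (towerLevel T s E l))
    {U : Set (Set X)} (hU : U ⊆ towerPartition T s h E) :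
    ∃ D : Set ℕ, ⋃₀ U = towerPosition T s h E ⁻¹' D := by
  refine ⟨towerPosition T s h E '' ⋃₀ U, Set.Subset.antisymm (Set.subset_preimage_image _ _) ?_⟩
  rintro y ⟨x, ⟨C, hCU, hxC⟩, hxy⟩
  refine ⟨C, hCU, ?_⟩
  rcases hU hCU with ⟨i, hi, rfl⟩ | hC
  · rw [← towerPosition_eq_iff hd hi] at hxC ⊢
    rw [← hxy, hxC]
  · rw [Set.mem_singleton_iff.1 hC] at hxC ⊢
    intro hy
    obtain ⟨i, hi, hyi⟩ := Set.mem_iUnion₂.1 hy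
    refine hxC (Set.mem_iUnion₂.2 ⟨i, hi, ?_⟩)
    rw [← towerPosition_eq_iff hd hi] at hyi ⊢
    rw [hxy, hyi]

end TowerPosition

section RankOne

variable {X : Type*} [MeasurableSpace X] {μ : Measure X} {T : ℝ → X → X}

lemma mem_towerLevel_iff (hT : IsFlow μ T) (s : ℝ) (E : Set X) (i : ℕ) (x : X) :
    x ∈ towerLevel T s E i ↔ T (-((i : ℝ) * s)) x ∈ E := by
  constructor
  · rintro ⟨y, hy, rfl⟩
    rwa [← hT.map_add, neg_add_cancel, hT.map_zero]
  · exact fun hx => ⟨_, hx, hT.apply_neg_apply _ _⟩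

lemma isTowerPosition_towerPosition (hT : IsFlow μ T) {s : ℝ} {h : ℕ} {E : Set X}
    (hE : MeasurableSet E)
    (hd : ∀ i < h, ∀ l < h, i ≠ l → Disjoint (towerLevel T s E i) (towerLevel T s E l)) :
    IsTowerPosition T s h (towerPosition T s h E) where
  le := towerPosition_le s h E
  shift i n x hin := by
    rw [towerPosition_eq_iff hd hin, towerPosition_eq_iff hd (by omega : i < h),
      mem_towerLevel_iff hT, mem_towerLevel_iff hT, ← hT.map_add]
    push_cast
    rw [show -(((i : ℝ) + n) * s) + n * s = -(i * s) by ring]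
  measurable := by
    have hlevel : ∀ i < h, MeasurableSet (towerPosition T s h E ⁻¹' {i}) := by
      intro i hi
      have : towerPosition T s h E ⁻¹' {i} = T (-((i : ℝ) * s)) ⁻¹' E := by
        ext x
        rw [Set.mem_preimage, Set.mem_singleton_iff, towerPosition_eq_iff hd hi,
          mem_towerLevel_iff hT, Set.mem_preimage]
      rw [this]
      exact (hT.measurePreserving _).measurable hE
    refine measurable_to_countable' fun i => ?_
    rcases lt_trichotomy i h with hi | rfl | hi
    · exact hlevel i hi
    · have : towerPosition T s i E ⁻¹' {i} =
          (⋃ l ∈ Finset.range i, towerPosition T s i E ⁻¹' {l})ᶜ := by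
        ext x
        have := towerPosition_le (T := T) s i E x
        simp only [Set.mem_preimage, Set.mem_singleton_iff, Set.mem_compl_iff, Set.mem_iUnion,
          Finset.mem_range, exists_prop, exists_eq_right']
        omega
      rw [this]
      exact (Finset.measurableSet_biUnion _ fun l hl => hlevel l (Finset.mem_range.1 hl)).compl
    · have : towerPosition T s h E ⁻¹' {i} = ∅ := by
        ext x
        have := towerPosition_le (T := T) s h E x
        simp only [Set.mem_preimage, Set.mem_singleton_iff, Set.mem_empty_iff_false, iff_false]
        omega
      rw [this]
      exact MeasurableSet.empty

/-- The positions `p j` in a sequence of towers describe every measurable set up to a small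
error. -/
def ApproximatesSets (μ : Measure X) (p : ℕ → X → ℕ) : Prop :=
  ∀ A, MeasurableSet A → ∀ η > 0, ∀ᶠ j in atTop, ∃ D : Set ℕ, μ.real (symmDiff A (p j ⁻¹' D)) ≤ η

lemma IsRankOneData.approximatesSets [IsFiniteMeasure μ] {s : ℕ → ℝ} {h : ℕ → ℕ} {E : ℕ → Set X}
    (hR : IsRankOneData μ T s h E) :
    ApproximatesSets μ fun j => towerPosition T (s j) (h j) (E j) := by
  intro A hA η hη
  obtain ⟨A', hA', hlim⟩ := hR.converges A hA
  have hlim' := (ENNReal.tendsto_toReal ENNReal.zero_ne_top).comp hlim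
  filter_upwards [hlim'.eventually (gt_mem_nhds (show (0 : ENNReal).toReal < η by simpa))] with j hj
  obtain ⟨U, hU, hAU⟩ := hA' j
  obtain ⟨D, hD⟩ := exists_preimage_towerPosition_eq (hR.disjoint_levels j) hU
  exact ⟨D, by rw [← hD, ← hAU]; exact hj.le⟩

/-- In a standard Borel space with a measure without atoms, countably many sets of small measure
cover the space. -/
lemma exists_iUnion_measureReal_lt [StandardBorelSpace X] [IsFiniteMeasure μ]
    [NullSingletonClass μ] {ε : ℝ} (hε : 0 < ε) :
    ∃ U : ℕ → Set X, (∀ n, MeasurableSet (U n)) ∧ (∀ n, μ.real (U n) ≤ ε) ∧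
      ⋃ n, U n = Set.univ := by
  let := upgradeStandardBorel X
  have h1 : ∀ x : X, ∃ U, x ∈ U ∧ IsOpen U ∧ μ U < ENNReal.ofReal ε := by
    intro x
    obtain ⟨U, hxU, hU, hμU⟩ := Set.exists_isOpen_lt_of_lt {x} (ENNReal.ofReal ε)
      (by rw [measure_singleton]; simpa : μ {x} < ENNReal.ofReal ε)
    exact ⟨U, hxU rfl, hU, hμU⟩
  choose U hxU hU hμU using h1
  obtain ⟨S, hS, hSU⟩ := TopologicalSpace.countable_cover_nhds fun x => (hU x).mem_nhds (hxU x)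
  rcases S.eq_empty_or_nonempty with rfl | hne
  · refine ⟨fun _ => ∅, fun _ => MeasurableSet.empty, fun _ => by simpa using hε.le, ?_⟩
    simpa using hSU
  · obtain ⟨a, ha⟩ := hS.exists_eq_range hne
    refine ⟨fun n => U (a n), fun n => (hU _).measurableSet, fun n => ?_, ?_⟩
    · exact ENNReal.toReal_le_of_le_ofReal hε.le (hμU _).le
    · rw [ha] at hSU
      simpa using hSU

/-- Since the measure has no atoms, the complements of the towers, being elements of partitions that
converge to the partition into points, have measures tending to `0`. -/
lemma ApproximatesSets.tendsto_measureReal_compl [StandardBorelSpace X] [IsFiniteMeasure μ]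
    [NullSingletonClass μ] {h : ℕ → ℕ} {p : ℕ → X → ℕ} (hp : ApproximatesSets μ p)
    (hle : ∀ j x, p j x ≤ h j) :
    Tendsto (fun j => μ.real {x | ¬ p j x < h j}) atTop (𝓝 0) := by
  rw [Metric.tendsto_nhds]
  intro ε hε
  obtain ⟨U, hUm, hUμ, hU⟩ := exists_iUnion_measureReal_lt (μ := μ)
    (show (0 : ℝ) < ε / 4 by positivity)
  have hlim : Tendsto (fun n => μ.real (Set.accumulate U n)ᶜ) atTop (𝓝 0) := by
    have h1 := tendsto_measure_iInter_atTop (μ := μ) (s := fun n => (Set.accumulate U n)ᶜ)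
      (fun n => (MeasurableSet.biUnion (Set.to_countable _)
        fun k _ => hUm k).compl.nullMeasurableSet)
      (fun m n hmn => Set.compl_subset_compl.2 (Set.monotone_accumulate hmn))
      ⟨0, measure_ne_top _ _⟩
    rw [← Set.compl_iUnion, Set.iUnion_accumulate, hU, Set.compl_univ, measure_empty] at h1
    exact (ENNReal.tendsto_toReal ENNReal.zero_ne_top).comp h1
  obtain ⟨N, hN⟩ := (hlim.eventually (gt_mem_nhds (show (0 : ℝ) < ε / 4 by positivity))).exists
  have hev : ∀ᶠ j in atTop, ∀ n ∈ Finset.range (N + 1), ∃ D : Set ℕ,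
      μ.real (symmDiff (U n) (p j ⁻¹' D)) ≤ ε / (4 * (N + 1)) :=
    (Filter.eventually_all_finset _).2 fun n _ => hp (U n) (hUm n) _ (by positivity)
  filter_upwards [hev] with j hj
  rw [Real.dist_eq, sub_zero, abs_of_nonneg measureReal_nonneg]
  choose! D hD using hj
  have hres : ∀ x ∈ {x | ¬ p j x < h j}, p j x = h j := fun x hx =>
    le_antisymm (hle j x) (not_lt.1 hx)
  have hN4 : ε / (4 * (N + 1)) ≤ ε / 4 := by
    refine div_le_div_of_nonneg_left hε.le (by positivity) ?_
    have : (0 : ℝ) ≤ N := Nat.cast_nonneg N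
    linarith
  -- If the complement of the tower belongs to the approximation of one of the sets `U n`, it is
  -- small because `U n` is; otherwise it is almost disjoint from all of them, and they cover
  -- most of the space.
  by_cases hex : ∃ n ∈ Finset.range (N + 1), h j ∈ D n
  · obtain ⟨n, hn, hD'⟩ := hex
    have hsub : {x | ¬ p j x < h j} ⊆ U n ∪ symmDiff (U n) (p j ⁻¹' D n) := by
      intro x hx
      by_cases hxU : x ∈ U n
      · exact Or.inl hxU
      · refine Or.inr (Or.inr ⟨?_, hxU⟩)
        rw [Set.mem_preimage, hres x hx]
        exact hD'
    have := (measureReal_mono hsub).trans (measureReal_union_le (μ := μ) _ _)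
    linarith [hUμ n, hD n hn]
  · push Not at hex
    have hsub : {x | ¬ p j x < h j} ⊆ (Set.accumulate U N)ᶜ ∪
        ⋃ n ∈ Finset.range (N + 1), symmDiff (U n) (p j ⁻¹' D n) := by
      intro x hx
      by_cases hxU : x ∈ Set.accumulate U N
      · obtain ⟨n, hn, hxn⟩ := Set.mem_accumulate.1 hxU
        have hn' : n ∈ Finset.range (N + 1) := Finset.mem_range.2 (by omega)
        refine Or.inr (Set.mem_iUnion₂.2 ⟨n, hn', Or.inl ⟨hxn, ?_⟩⟩)
        rw [Set.mem_preimage, hres x hx]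
        exact hex n hn'
      · exact Or.inl hxU
    have h1 := (measureReal_mono hsub).trans (measureReal_union_le (μ := μ) _ _)
    have h2 := measureReal_biUnion_finset_le (μ := μ) (Finset.range (N + 1))
      fun n => symmDiff (U n) (p j ⁻¹' D n)
    have h3 := Finset.sum_le_card_nsmul _ _ _ hD
    have h4 : (N + 1 : ℝ) * (ε / (4 * (N + 1))) = ε / 4 := by field_simp
    rw [Finset.card_range, nsmul_eq_mul, Nat.cast_succ, h4] at h3
    linarith

/-- Layer by layer, a function with values in the unit interval is approximated by functions of the
position in the tower. -/
lemma ApproximatesSets.eventually_exists_integral_le [IsProbabilityMeasure μ] {p : ℕ → X → ℕ}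
    (hp : ApproximatesSets μ p) (hpm : ∀ j, Measurable (p j)) {u : X → ℝ} (hu : Measurable u)
    (hu01 : ∀ x, u x ∈ Set.Icc (0 : ℝ) 1) {η : ℝ} (hη : 0 < η) :
    ∀ᶠ j in atTop, ∃ c : ℕ → ℝ, (∀ i, c i ∈ Set.Icc (0 : ℝ) 1) ∧
      ∫ x, |u x - c (p j x)| ∂μ ≤ η := by
  classical
  obtain ⟨n, hn⟩ := exists_nat_gt (2 / η)
  have hn0 : (0 : ℝ) < n := (by positivity : 0 < 2 / η).trans hn
  have hnη : 1 / (n : ℝ) ≤ η / 2 := by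
    rw [div_lt_iff₀ hη] at hn
    rw [div_le_div_iff₀ hn0 two_pos]
    linarith
  set A : ℕ → Set X := fun k => {x | (k + 1 : ℕ) ≤ n * u x} with hA
  have hAm : ∀ k, MeasurableSet (A k) := fun k =>
    measurableSet_le measurable_const (measurable_const.mul hu)
  have hev : ∀ᶠ j in atTop, ∀ k ∈ Finset.range n, ∃ D : Set ℕ,
      μ.real (symmDiff (A k) (p j ⁻¹' D)) ≤ η / 2 :=
    (Filter.eventually_all_finset _).2 fun k _ => hp (A k) (hAm k) _ (by positivity)
  filter_upwards [hev] with j hj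
  choose! D hD using hj
  set c : ℕ → ℝ := fun i => (∑ k ∈ Finset.range n, (D k).indicator (fun _ => (1 : ℝ)) i) / n with hc
  have hc01 : ∀ i, c i ∈ Set.Icc (0 : ℝ) 1 := by
    intro i
    have h1 : ∀ k ∈ Finset.range n, (D k).indicator (fun _ => (1 : ℝ)) i ≤ 1 := fun k _ =>
      Set.indicator_le_self' (fun _ _ => zero_le_one) i
    have h2 := Finset.sum_le_card_nsmul _ _ _ h1
    rw [Finset.card_range, nsmul_eq_mul, mul_one] at h2
    exact ⟨div_nonneg (Finset.sum_nonneg fun k _ => Set.indicator_nonneg (fun _ _ => zero_le_one) i)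
      hn0.le, (div_le_one hn0).2 h2⟩
  refine ⟨c, hc01, ?_⟩
  -- The layers `A k` sum up to the integer part of `n * u`.
  have hlayer : ∀ x, |u x - (∑ k ∈ Finset.range n, (A k).indicator (fun _ => (1 : ℝ)) x) / n| ≤
      1 / n := by
    intro x
    have h0 : 0 ≤ n * u x := mul_nonneg hn0.le (hu01 x).1
    have h1 : n * u x ≤ n := mul_le_of_le_one_right hn0.le (hu01 x).2
    have hfl : ⌊n * u x⌋₊ ≤ n := by
      have := Nat.floor_le_floor h1
      rwa [Nat.floor_natCast] at this
    have hsum : ∑ k ∈ Finset.range n, (A k).indicator (fun _ => (1 : ℝ)) x = (⌊n * u x⌋₊ : ℝ) := by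
      have e1 : ∀ k ∈ Finset.range n, (A k).indicator (fun _ => (1 : ℝ)) x =
          if k < ⌊n * u x⌋₊ then 1 else 0 := by
        intro k _
        rw [Set.indicator_apply]
        refine if_congr ?_ rfl rfl
        rw [hA, Set.mem_ofPred_eq, ← Nat.le_floor_iff h0, Nat.succ_le_iff]
      rw [Finset.sum_congr rfl e1, Finset.sum_boole]
      congr 1
      have : (Finset.range n).filter (fun k => k < ⌊n * u x⌋₊) = Finset.range ⌊n * u x⌋₊ := by
        ext k
        simp only [Finset.mem_filter, Finset.mem_range]
        omega
      rw [this, Finset.card_range]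
    rw [hsum]
    have h2 := Nat.floor_le h0
    have h3 := (Nat.lt_floor_add_one (n * u x)).le
    have e : u x - (⌊n * u x⌋₊ : ℝ) / n = (n * u x - ⌊n * u x⌋₊) / n := by field_simp
    rw [e, abs_of_nonneg (div_nonneg (by linarith) hn0.le)]
    exact div_le_div_of_nonneg_right (by linarith) hn0.le
  have hpt : ∀ x, |u x - c (p j x)| ≤ 1 / n + (∑ k ∈ Finset.range n,
      (symmDiff (A k) (p j ⁻¹' D k)).indicator (fun _ => (1 : ℝ)) x) / n := by
    intro x
    refine (abs_sub_le _ _ _).trans (add_le_add (hlayer x) ?_)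
    rw [hc, ← sub_div, abs_div, abs_of_pos hn0, ← Finset.sum_sub_distrib]
    refine div_le_div_of_nonneg_right ((Finset.abs_sum_le_sum_abs _ _).trans
      (Finset.sum_le_sum fun k _ => ?_)) hn0.le
    by_cases h1 : x ∈ A k <;> by_cases h2 : p j x ∈ D k <;>
      simp [Set.mem_symmDiff, h1, h2]
  have hsm : ∀ k, MeasurableSet (symmDiff (A k) (p j ⁻¹' D k)) := fun k =>
    (hAm k).symmDiff (hpm j (MeasurableSet.of_discrete))
  have hi : ∀ k, Integrable
      ((symmDiff (A k) (p j ⁻¹' D k)).indicator (fun _ => (1 : ℝ))) μ := fun k =>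
    (integrable_const _).indicator (hsm k)
  have hcm : Measurable fun x => c (p j x) := (measurable_of_countable c).comp (hpm j)
  have hi2 : Integrable (fun x => |u x - c (p j x)|) μ :=
    ((integrable_of_measurable_of_mem_Icc hu hu01).sub
      (integrable_of_measurable_of_mem_Icc hcm fun x => hc01 _)).abs
  have hi3 : Integrable (fun x => (∑ k ∈ Finset.range n,
      (symmDiff (A k) (p j ⁻¹' D k)).indicator (fun _ => (1 : ℝ)) x) / n) μ :=
    (integrable_finsetSum _ fun k _ => hi k).div_const _
  have h4 : ∫ x, |u x - c (p j x)| ∂μ ≤ ∫ x, (1 / (n : ℝ) + (∑ k ∈ Finset.range n,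
      (symmDiff (A k) (p j ⁻¹' D k)).indicator (fun _ => (1 : ℝ)) x) / n) ∂μ :=
    integral_mono hi2 ((integrable_const _).add hi3) hpt
  refine h4.trans ?_
  have h5 := Finset.sum_le_card_nsmul _ _ _ hD
  rw [Finset.card_range, nsmul_eq_mul] at h5
  rw [integral_add (integrable_const _) hi3, integral_div _ fun x => ∑ k ∈ _, _,
    integral_finsetSum _ fun k _ => hi k]
  simp only [integral_indicator_const _ (hsm _), smul_eq_mul, mul_one, integral_const, probReal_univ,
    one_mul]
  have h6 : (∑ k ∈ Finset.range n, μ.real (symmDiff (A k) (p j ⁻¹' D k))) / n ≤ η / 2 := by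
    rw [div_le_iff₀ hn0, mul_comm]; exact h5
  linarith

end RankOne

/-! ### Uniqueness of the invariant measure -/

section Ergodicity

variable {X : Type*} [MeasurableSpace X] {μ : Measure X} {T : ℝ → X → X}

/-- The number `q` depends only on `D` and `h`: up to the mass of the complement of the tower, all
invariant measures agree on the unions of levels. -/
lemma IsTowerPosition.abs_measureReal_preimage_sub_le [IsProbabilityMeasure μ]
    (hT : IsFlow μ T) {s : ℝ} {h : ℕ} {p : X → ℕ} (hp : IsTowerPosition T s h p) (hh : 0 < h)
    (D : Set ℕ) {q : ℝ}
    (hq : q = (∑ i ∈ Finset.range h, D.indicator (fun _ => (1 : ℝ)) i) / h) :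
    |μ.real (p ⁻¹' D) - q| ≤ μ.real {x | ¬ p x < h} := by
  have hh' : (0 : ℝ) < h := by exact_mod_cast hh
  have hlt : MeasurableSet {x | p x < h} := hp.measurable (measurableSet_Iio (a := h))
  have hDm : MeasurableSet (p ⁻¹' D) := hp.measurable MeasurableSet.of_discrete
  have h1 := hp.setIntegral_comp hT le_rfl (D.indicator fun _ => (1 : ℝ))
  have h2 : ∫ x in {x | p x < h}, D.indicator (fun _ => (1 : ℝ)) (p x) ∂μ =
      μ.real (p ⁻¹' D ∩ {x | p x < h}) := by
    have : (fun x => D.indicator (fun _ => (1 : ℝ)) (p x)) =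
        (p ⁻¹' D).indicator fun _ => (1 : ℝ) := by
      rfl
    rw [this, integral_indicator_const _ hDm, measureReal_restrict_apply hDm, smul_eq_mul, mul_one]
  have h3 := hp.height_mul_measureReal_base hT
  have h4 : μ.real (p ⁻¹' D ∩ {x | p x < h}) ≤ μ.real (p ⁻¹' D) :=
    measureReal_mono Set.inter_subset_left
  have h5 : μ.real (p ⁻¹' D) ≤ μ.real (p ⁻¹' D ∩ {x | p x < h}) + μ.real {x | ¬ p x < h} := by
    refine (measureReal_mono fun x hx => ?_).trans (measureReal_union_le _ _)
    by_cases hx' : p x < h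
    · exact Or.inl ⟨hx, hx'⟩
    · exact Or.inr hx'
  have hN0 : 0 ≤ ∑ i ∈ Finset.range h, D.indicator (fun _ => (1 : ℝ)) i :=
    Finset.sum_nonneg fun k _ => Set.indicator_nonneg (fun _ _ => zero_le_one) k
  have hN1 : ∑ i ∈ Finset.range h, D.indicator (fun _ => (1 : ℝ)) i ≤ h := by
    have := Finset.sum_le_card_nsmul (Finset.range h) (D.indicator fun _ => (1 : ℝ)) 1 fun k _ =>
      Set.indicator_le_self' (fun _ _ => zero_le_one) k
    simpa using this
  have hr0 : 0 ≤ μ.real {x | ¬ p x < h} := measureReal_nonneg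
  rw [h2] at h1
  have hq0 : 0 ≤ q := hq ▸ div_nonneg hN0 hh'.le
  have hq1 : q ≤ 1 := hq ▸ (div_le_one hh').2 hN1
  have h6 : μ.real (p ⁻¹' D ∩ {x | p x < h}) = q * (1 - μ.real {x | ¬ p x < h}) := by
    rw [h1, ← h3, hq]; field_simp
  have h7 : q * μ.real {x | ¬ p x < h} ≤ μ.real {x | ¬ p x < h} :=
    mul_le_of_le_one_left hr0 hq1
  have h8 : 0 ≤ q * μ.real {x | ¬ p x < h} := mul_nonneg hq0 hr0
  rw [abs_le]
  constructor <;> linarith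

/-- Unique ergodicity of a rank-one flow within the class of measures dominated by a multiple of
`μ`: an invariant measure gives the same mass to all the levels of a tower. -/
lemma measureReal_eq_of_invariant_of_le [IsProbabilityMeasure μ]
    (hT : IsFlow μ T) {s : ℕ → ℝ} {h : ℕ → ℕ} {p : ℕ → X → ℕ} (hh : ∀ j, 0 < h j)
    (hp : ∀ j, IsTowerPosition T (s j) (h j) (p j))
    (hcover : Tendsto (fun j => μ.real {x | ¬ p j x < h j}) atTop (𝓝 0))
    (happrox : ApproximatesSets μ p) {ρ : Measure X} [IsProbabilityMeasure ρ] {C : ℝ}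
    (hinv : ∀ t, MeasurePreserving (T t) ρ ρ) (hC0 : 0 ≤ C)
    (hC : ∀ A, MeasurableSet A → ρ.real A ≤ C * μ.real A) : ρ = μ := by
  have hTρ : IsFlow ρ T := ⟨hT.measurable_uncurry, hT.map_zero, hT.map_add, hinv⟩
  refine Measure.ext fun A hA => ?_
  rw [← measureReal_eq_measureReal_iff]
  refine eq_of_abs_sub_le_all fun ε hε => ?_
  obtain ⟨η, hη0, hη⟩ : ∃ η > 0, 2 * (C + 1) * η = ε := ⟨ε / (2 * (C + 1)), by positivity, by
    field_simp⟩
  obtain ⟨j, hj, D, hD⟩ := ((hcover.eventually (gt_mem_nhds hη0)).and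
    (happrox A hA η hη0)).exists
  have hlt : MeasurableSet {x | ¬ p j x < h j} :=
    ((hp j).measurable (measurableSet_Iio (a := h j))).compl
  have hDm : MeasurableSet (p j ⁻¹' D) := (hp j).measurable MeasurableSet.of_discrete
  have h1 := (hp j).abs_measureReal_preimage_sub_le hT (hh j) D rfl
  have h2 := (hp j).abs_measureReal_preimage_sub_le hTρ (hh j) D rfl
  generalize (∑ i ∈ Finset.range (h j), D.indicator (fun _ => (1 : ℝ)) i) / h j = q at *
  have h3 := hC _ hlt
  have h4 := hC _ (hA.symmDiff hDm)
  have h5 : |μ.real A - μ.real (p j ⁻¹' D)| ≤ μ.real (symmDiff A (p j ⁻¹' D)) :=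
    abs_measureReal_sub_le_measureReal_symmDiff hA.nullMeasurableSet hDm.nullMeasurableSet
  have h6 : |ρ.real A - ρ.real (p j ⁻¹' D)| ≤ ρ.real (symmDiff A (p j ⁻¹' D)) :=
    abs_measureReal_sub_le_measureReal_symmDiff hA.nullMeasurableSet hDm.nullMeasurableSet
  have h7 : C * μ.real {x | ¬ p j x < h j} ≤ C * η := mul_le_mul_of_nonneg_left hj.le hC0
  have h8 : C * μ.real (symmDiff A (p j ⁻¹' D)) ≤ C * η := mul_le_mul_of_nonneg_left hD hC0
  rw [abs_le] at h1 h2 h5 h6 ⊢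
  constructor <;> linarith

end Ergodicity

/-! ### The relatively independent joining -/

section Joining

open ProbabilityTheory

variable {X : Type*} {F : MeasurableSpace X} [mX : MeasurableSpace X] {μ : Measure X}
  {T : ℝ → X → X}

lemma IsFactor.measurable (hT : IsFlow μ T) (hF : IsFactor F T) (t : ℝ) :
    Measurable[F, F] (T t) := by
  intro A hA
  have : T t ⁻¹' A = T (-t) '' A := by
    ext x
    constructor
    · exact fun hx => ⟨T t x, hx, by rw [← hT.map_add, neg_add_cancel, hT.map_zero]⟩
    · rintro ⟨y, hy, rfl⟩
      rwa [Set.mem_preimage, hT.apply_neg_apply]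
  rw [this]
  exact hF.invariant (-t) A hA

variable [StandardBorelSpace X] [IsProbabilityMeasure μ]

/-- The conditional probabilities given an invariant σ-algebra are equivariant. -/
lemma condExpKernel_preimage_ae_eq (hT : IsFlow μ T) (hF : IsFactor F T) (t : ℝ) {A : Set X}
    (hA : MeasurableSet A) :
    (fun x => (condExpKernel μ F x).real (T t ⁻¹' A)) =ᵐ[μ]
      fun x => (condExpKernel μ F (T t x)).real A := by
  have mp := hT.measurePreserving t
  have hA' : MeasurableSet (T t ⁻¹' A) := mp.measurable hA
  refine (condExpKernel_ae_eq_condExp hF.le hA').trans ?_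
  refine EventuallyEq.trans ?_ (mp.quasiMeasurePreserving.ae_eq_comp
    (condExpKernel_ae_eq_condExp hF.le hA)).symm
  have hint : Integrable (A.indicator fun _ => (1 : ℝ)) μ := (integrable_const _).indicator hA
  refine (ae_eq_condExp_of_forall_setIntegral_eq hF.le ((integrable_const _).indicator hA')
    (fun B _ _ => (mp.integrable_comp_of_integrable integrable_condExp).integrableOn)
    (fun B hB _ => ?_)
    (stronglyMeasurable_condExp.comp_measurable (hF.measurable hT t)).aestronglyMeasurable).symm
  have hB' : MeasurableSet[F] (T (-t) ⁻¹' B) := hF.measurable hT (-t) hB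
  have hBB : B = T t ⁻¹' (T (-t) ⁻¹' B) := by
    ext x
    simp [← hT.map_add, hT.map_zero]
  have e1 : ∀ g : X → ℝ, AEStronglyMeasurable g μ →
      ∫ x in B, g (T t x) ∂μ = ∫ x in T (-t) ⁻¹' B, g x ∂μ := by
    intro g hg
    conv_rhs => rw [← mp.map_eq]
    rw [setIntegral_map (hF.le _ hB') (by rwa [mp.map_eq]) mp.aemeasurable, ← hBB]
  have e2 := e1 _ (integrable_condExp (m := F) (f := A.indicator fun _ => (1 : ℝ))
    (μ := μ)).aestronglyMeasurable
  have e3 := e1 _ hint.aestronglyMeasurable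
  rw [setIntegral_condExp hF.le hint hB', ← e3] at e2
  exact e2

/-- The relatively independent self-joining over the factor `F`: two points are chosen
independently according to the conditional probability given `F`. -/
noncomputable def relIndepJoining (hF : F ≤ mX) (μ : Measure X) [IsProbabilityMeasure μ] :
    Measure (X × X) :=
  μ.bind (((condExpKernel μ F).comap id (measurable_id'' hF)) ×ₖ
    ((condExpKernel μ F).comap id (measurable_id'' hF)))

instance (hF : F ≤ mX) : IsProbabilityMeasure (relIndepJoining hF μ) := by
  unfold relIndepJoining
  infer_instance

lemma relIndepJoining_prod (hF : F ≤ mX) {A B : Set X} (hA : MeasurableSet A)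
    (hB : MeasurableSet B) :
    (relIndepJoining hF μ).real (A ×ˢ B) =
      ∫ x, (condExpKernel μ F x).real A * (condExpKernel μ F x).real B ∂μ := by
  have hm : ∀ {C : Set X}, MeasurableSet C → Measurable fun x => condExpKernel μ F x C := fun hC =>
    (measurable_condExpKernel hC).mono hF le_rfl
  rw [measureReal_def, relIndepJoining, Measure.bind_apply (hA.prod hB) (Kernel.aemeasurable _),
    ← integral_toReal]
  · simp only [Kernel.prod_apply_prod, Kernel.comap_apply, id, ENNReal.toReal_mul, measureReal_def]
  · simp only [Kernel.prod_apply_prod, Kernel.comap_apply, id]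
    exact ((hm hA).mul (hm hB)).aemeasurable
  · exact Eventually.of_forall fun x => measure_lt_top _ _

lemma integral_condExpKernel_real (hF : F ≤ mX) {A : Set X} (hA : MeasurableSet A) :
    ∫ x, (condExpKernel μ F x).real A ∂μ = μ.real A := by
  rw [integral_congr_ae (condExpKernel_ae_eq_condExp hF hA), integral_condExp hF,
    integral_indicator_const _ hA, smul_eq_mul, mul_one]

lemma measurePreserving_fst_relIndepJoining (hF : F ≤ mX) :
    MeasurePreserving Prod.fst (relIndepJoining hF μ) μ := by
  refine ⟨measurable_fst, Measure.ext fun A hA => ?_⟩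
  rw [Measure.map_apply measurable_fst hA, ← measureReal_eq_measureReal_iff, ← Set.prod_univ,
    relIndepJoining_prod hF hA MeasurableSet.univ]
  simp only [probReal_univ, mul_one]
  exact integral_condExpKernel_real hF hA

lemma measurePreserving_snd_relIndepJoining (hF : F ≤ mX) :
    MeasurePreserving Prod.snd (relIndepJoining hF μ) μ := by
  refine ⟨measurable_snd, Measure.ext fun A hA => ?_⟩
  rw [Measure.map_apply measurable_snd hA, ← measureReal_eq_measureReal_iff, ← Set.univ_prod,
    relIndepJoining_prod hF MeasurableSet.univ hA]
  simp only [probReal_univ, one_mul]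
  exact integral_condExpKernel_real hF hA

lemma measurePreserving_prodMap_relIndepJoining (hT : IsFlow μ T) (hF : IsFactor F T) (t : ℝ) :
    MeasurePreserving (Prod.map (T t) (T t)) (relIndepJoining hF.le μ)
      (relIndepJoining hF.le μ) := by
  have mp := hT.measurePreserving t
  have hm : Measurable (Prod.map (T t) (T t)) := mp.measurable.prodMap mp.measurable
  refine ⟨hm, ?_⟩
  have := Measure.isProbabilityMeasure_map (μ := relIndepJoining hF.le μ) hm.aemeasurable
  refine Measure.ext_prod fun {A B} hA hB => ?_
  rw [Measure.map_apply hm (hA.prod hB), ← measureReal_eq_measureReal_iff,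
    Set.preimage_prod_map_prod, relIndepJoining_prod hF.le (mp.measurable hA) (mp.measurable hB),
    relIndepJoining_prod hF.le hA hB]
  have hmr : ∀ {C : Set X}, MeasurableSet C → Measurable fun x => (condExpKernel μ F x).real C :=
    fun hC => ((measurable_condExpKernel hC).mono hF.le le_rfl).ennreal_toReal
  have e1 : ∫ x, (condExpKernel μ F x).real A * (condExpKernel μ F x).real B ∂μ =
      ∫ x, (condExpKernel μ F (T t x)).real A * (condExpKernel μ F (T t x)).real B ∂μ := by
    have := integral_map mp.aemeasurable
      ((hmr hA).mul (hmr hB)).aestronglyMeasurable (μ := μ)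
    rwa [mp.map_eq] at this
  rw [e1]
  refine integral_congr_ae ?_
  filter_upwards [condExpKernel_preimage_ae_eq hT hF t hA,
    condExpKernel_preimage_ae_eq hT hF t hB] with x h1 h2
  rw [h1, h2]

/-- The two points of the relatively independent joining lie in the same sets of the factor. -/
lemma relIndepJoining_prod_compl (hF : F ≤ mX) {A : Set X} (hA : MeasurableSet[F] A) :
    relIndepJoining hF μ (A ×ˢ Aᶜ) = 0 := by
  have h1 : ∀ {B : Set X}, MeasurableSet[F] B →
      (fun x => (condExpKernel μ F x).real B) =ᵐ[μ] B.indicator fun _ => (1 : ℝ) := by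
    intro B hB
    refine (condExpKernel_ae_eq_condExp hF (hF _ hB)).trans ?_
    rw [condExp_of_stronglyMeasurable hF (stronglyMeasurable_const.indicator hB)
      ((integrable_const _).indicator (hF _ hB))]
  have h2 : (relIndepJoining hF μ).real (A ×ˢ Aᶜ) = 0 := by
    rw [relIndepJoining_prod hF (hF _ hA) (hF _ hA).compl]
    rw [integral_congr_ae (g := fun _ => (0 : ℝ)), integral_zero]
    filter_upwards [h1 hA, h1 hA.compl] with x e1 e2
    rw [e1, e2]
    by_cases hx : x ∈ A <;> simp [hx]
  rwa [measureReal_eq_zero_iff] at h2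

/-- Over a proper factor the relatively independent joining is not carried by the diagonal:
otherwise all the conditional probabilities given `F` would be `0` or `1`, so that every measurable
set would be a set of the factor. -/
lemma relIndepJoining_compl_diagonal_ne_zero (hF : F ≤ mX) (hF' : IsProperModNull F μ) :
    relIndepJoining hF μ (Set.diagonal X)ᶜ ≠ 0 := by
  intro hzero
  obtain ⟨A, hA, hAF⟩ := hF'
  have h1 : (relIndepJoining hF μ).real (A ×ˢ Aᶜ) = 0 := by
    rw [measureReal_eq_zero_iff]
    refine measure_mono_null ?_ hzero
    rintro ⟨x, y⟩ ⟨hx, hy⟩ (hxy : x = y)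
    exact hy (hxy ▸ hx)
  have hmr : ∀ {C : Set X}, MeasurableSet C → Measurable fun x => (condExpKernel μ F x).real C :=
    fun hC => ((measurable_condExpKernel hC).mono hF le_rfl).ennreal_toReal
  have hint : Integrable
      (fun x => (condExpKernel μ F x).real A * (condExpKernel μ F x).real Aᶜ) μ :=
    integrable_of_measurable_of_mem_Icc ((hmr hA).mul (hmr hA.compl)) fun x =>
      ⟨mul_nonneg measureReal_nonneg measureReal_nonneg,
        mul_le_one₀ measureReal_le_one measureReal_nonneg measureReal_le_one⟩
  rw [relIndepJoining_prod hF hA hA.compl, integral_eq_zero_iff_of_nonneg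
    (fun x => mul_nonneg measureReal_nonneg measureReal_nonneg) hint] at h1
  set P : X → ℝ := fun x => (condExpKernel μ F x).real A with hP
  set B : Set X := {x | P x = 1} with hB
  have hBm : MeasurableSet[F] B := by
    have : Measurable[F] P := (measurable_condExpKernel hA).ennreal_toReal
    exact this (measurableSet_singleton 1)
  have hPB : P =ᵐ[μ] B.indicator fun _ => (1 : ℝ) := by
    filter_upwards [h1] with x hx
    rw [Pi.zero_apply, probReal_compl_eq_one_sub hA] at hx
    by_cases hxB : x ∈ B
    · rw [Set.indicator_of_mem hxB]; exact hxB
    · rw [Set.indicator_of_notMem hxB]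
      rcases mul_eq_zero.1 hx with h | h
      · exact h
      · exact absurd (sub_eq_zero.1 h).symm hxB
  have key : ∀ C, MeasurableSet[F] C → μ.real (A ∩ C) = μ.real (B ∩ C) := by
    intro C hC
    have e1 : ∫ x in C, P x ∂μ = μ.real (A ∩ C) := by
      rw [integral_congr_ae (ae_restrict_of_ae (condExpKernel_ae_eq_condExp hF hA)),
        setIntegral_condExp hF ((integrable_const _).indicator hA) hC,
        integral_indicator_const _ hA, smul_eq_mul, mul_one, measureReal_restrict_apply hA]
    rw [← e1, integral_congr_ae (ae_restrict_of_ae hPB), integral_indicator_const _ (hF _ hBm),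
      smul_eq_mul, mul_one, measureReal_restrict_apply (hF _ hBm)]
  refine hAF B hBm (ae_eq_set.2 ⟨?_, ?_⟩)
  · have := key Bᶜ hBm.compl
    rw [Set.inter_compl_self, measureReal_empty] at this
    rwa [Set.sdiff_eq, ← measureReal_eq_zero_iff]
  · have := key B hBm
    rw [Set.inter_self] at this
    have h2 := measureReal_inter_add_sdiff (μ := μ) (s := B) hA
    rw [Set.inter_comm, this] at h2
    rw [← measureReal_eq_zero_iff]
    linarith

end Joining

section OffDiagonal

open ProbabilityTheory

variable {X : Type*} {F : MeasurableSpace X} [mX : MeasurableSpace X] {μ : Measure X}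
  {T : ℝ → X → X}

/-- An equivariant factor map to a rank-one flow remains measure preserving when the measure is
conditioned on an invariant set. -/
lemma measurePreserving_cond_of_invariant {Ω : Type*} [MeasurableSpace Ω] [IsProbabilityMeasure μ]
    (hT : IsFlow μ T) {s : ℕ → ℝ} {h : ℕ → ℕ} {p : ℕ → X → ℕ} (hh : ∀ j, 0 < h j)
    (hp : ∀ j, IsTowerPosition T (s j) (h j) (p j))
    (hcover : Tendsto (fun j => μ.real {x | ¬ p j x < h j}) atTop (𝓝 0))
    (happrox : ApproximatesSets μ p) {ν : Measure Ω} [IsProbabilityMeasure ν] {S : Set Ω}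
    (hS : MeasurableSet S) (hS0 : ν S ≠ 0) {R : ℝ → Ω → Ω}
    (hR : ∀ t, MeasurePreserving (R t) ν[|S] ν[|S]) {π : Ω → X}
    (hπ : MeasurePreserving π ν μ) (hπR : ∀ t z, π (R t z) = T t (π z)) :
    MeasurePreserving π ν[|S] μ := by
  have := cond_isProbabilityMeasure hS0
  have := Measure.isProbabilityMeasure_map (μ := ν[|S]) hπ.measurable.aemeasurable
  refine ⟨hπ.measurable, measureReal_eq_of_invariant_of_le hT hh hp hcover happrox
    (C := (ν.real S)⁻¹) (fun t => ⟨(hT.measurePreserving t).measurable, ?_⟩)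
    (inv_nonneg.2 measureReal_nonneg) fun A hA => ?_⟩
  · rw [Measure.map_map (hT.measurePreserving t).measurable hπ.measurable]
    conv_rhs => rw [← (hR t).map_eq]
    rw [Measure.map_map hπ.measurable (hR t).measurable]
    congr 1
    ext z
    exact (hπR t z).symm
  · rw [map_measureReal_apply hπ.measurable hA, measureReal_def, cond_apply hS, ENNReal.toReal_mul,
      ENNReal.toReal_inv, ← hπ.measureReal_preimage hA.nullMeasurableSet]
    exact mul_le_mul_of_nonneg_left (measureReal_mono Set.inter_subset_right)
      (inv_nonneg.2 measureReal_nonneg)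

/-- A proper factor of a rank-one flow admits a self-joining over the factor that does not charge
the diagonal. -/
lemma exists_selfJoining_of_isProperModNull [StandardBorelSpace X] [IsProbabilityMeasure μ]
    (hT : IsFlow μ T) {s : ℕ → ℝ} {h : ℕ → ℕ} {p : ℕ → X → ℕ} (hh : ∀ j, 0 < h j)
    (hp : ∀ j, IsTowerPosition T (s j) (h j) (p j))
    (hcover : Tendsto (fun j => μ.real {x | ¬ p j x < h j}) atTop (𝓝 0))
    (happrox : ApproximatesSets μ p) (hF : IsFactor F T) (hF' : IsProperModNull F μ) :
    ∃ ν : Measure (X × X), IsProbabilityMeasure ν ∧ IsSelfJoining T μ ν ∧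
      (∀ A, MeasurableSet[F] A → ν (A ×ˢ Aᶜ) = 0) ∧ ν (Set.diagonal X) = 0 := by
  set S : Set (X × X) := (Set.diagonal X)ᶜ with hS
  have hSm : MeasurableSet S := measurableSet_diagonal.compl
  have hS0 := relIndepJoining_compl_diagonal_ne_zero (μ := μ) hF.le hF'
  have hinv : ∀ t, MeasurePreserving (Prod.map (T t) (T t)) ((relIndepJoining hF.le μ)[|S])
      ((relIndepJoining hF.le μ)[|S]) := by
    intro t
    have hpre : Prod.map (T t) (T t) ⁻¹' S = S := by
      ext z
      simp only [hS, Set.mem_preimage, Set.mem_compl_iff, Set.mem_diagonal_iff, Prod.map_fst,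
        Prod.map_snd]
      refine not_congr ⟨fun hz => ?_, fun hz => by rw [hz]⟩
      have := congrArg (T (-t)) hz
      rwa [← hT.map_add, ← hT.map_add, neg_add_cancel, hT.map_zero, hT.map_zero] at this
    have h1 := (measurePreserving_prodMap_relIndepJoining hT hF t).restrict_preimage hSm
    rw [hpre] at h1
    exact h1.smul_measure _
  refine ⟨(relIndepJoining hF.le μ)[|S], cond_isProbabilityMeasure hS0, ⟨?_, ?_, hinv⟩, ?_, ?_⟩
  · exact measurePreserving_cond_of_invariant hT hh hp hcover happrox hSm hS0 hinv
      (measurePreserving_fst_relIndepJoining hF.le) fun t z => rfl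
  · exact measurePreserving_cond_of_invariant hT hh hp hcover happrox hSm hS0 hinv
      (measurePreserving_snd_relIndepJoining hF.le) fun t z => rfl
  · exact fun A hA => cond_absolutelyContinuous (relIndepJoining_prod_compl hF.le hA)
  · rw [cond_apply hSm, hS, Set.compl_inter_self, measure_empty, mul_zero]

end OffDiagonal

/-! ### A function generating the factor -/

section CodingFunction

variable {X : Type*}

open Classical in
/-- The function with values in the Cantor set whose ternary digits are `2` or `0` according to
whether the given point lies in the sets `A n`. -/
noncomputable def codingFunction (A : ℕ → Set X) (x : X) : ℝ :=
  2 / 3 * Cardinal.cantorFunction (1 / 3) fun n => decide (x ∈ A n)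

lemma cantorFunction_third_mem_Icc (a : ℕ → Bool) :
    Cardinal.cantorFunction (1 / 3) a ∈ Set.Icc (0 : ℝ) (3 / 2) := by
  refine ⟨tsum_nonneg fun n => Cardinal.cantorFunctionAux_nonneg (by norm_num), ?_⟩
  refine (Cardinal.cantorFunction_le (g := fun _ => true) (by norm_num) (by norm_num)
    fun _ _ => rfl).trans (le_of_eq ?_)
  have : ∀ n, Cardinal.cantorFunctionAux (1 / 3) (fun _ => true) n = (1 / 3 : ℝ) ^ n := fun n =>
    Cardinal.cantorFunctionAux_true rfl
  rw [Cardinal.cantorFunction, tsum_congr this, tsum_geometric_of_lt_one (by norm_num) (by norm_num)]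
  norm_num

/-- The expansions with ratio `1 / 3` separate their digits, as the first digit outweighs all the
subsequent ones together. -/
lemma le_abs_cantorFunction_sub (n : ℕ) : ∀ a b : ℕ → Bool, a n ≠ b n →
    1 / 2 * (1 / 3) ^ n ≤
      |Cardinal.cantorFunction (1 / 3) a - Cardinal.cantorFunction (1 / 3) b| := by
  have first : ∀ a b : ℕ → Bool, a 0 ≠ b 0 →
      1 / 2 ≤ |Cardinal.cantorFunction (1 / 3) a - Cardinal.cantorFunction (1 / 3) b| := by
    intro a b hab
    rw [Cardinal.cantorFunction_succ a (by norm_num) (by norm_num),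
      Cardinal.cantorFunction_succ b (by norm_num) (by norm_num)]
    have h1 := cantorFunction_third_mem_Icc fun n => a (n + 1)
    have h2 := cantorFunction_third_mem_Icc fun n => b (n + 1)
    generalize Cardinal.cantorFunction (1 / 3) (fun n => a (n + 1)) = u at *
    generalize Cardinal.cantorFunction (1 / 3) (fun n => b (n + 1)) = v at *
    obtain ⟨h3, h4⟩ := h1
    obtain ⟨h5, h6⟩ := h2
    rw [le_abs]
    cases ha : a 0 <;> cases hb : b 0 <;> simp [ha, hb] at hab ⊢
    · right; linarith
    · left; linarith
  induction n with
  | zero => intro a b hab; simpa using first a b hab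
  | succ n ih =>
    intro a b hab
    by_cases h0 : a 0 = b 0
    · have := ih (fun n => a (n + 1)) (fun n => b (n + 1)) hab
      rw [Cardinal.cantorFunction_succ a (by norm_num) (by norm_num),
        Cardinal.cantorFunction_succ b (by norm_num) (by norm_num), h0, add_sub_add_left_eq_sub,
        ← mul_sub, abs_mul, pow_succ, abs_of_pos (by norm_num : (0 : ℝ) < 1 / 3)]
      linarith
    · have h1 : ((1 : ℝ) / 3) ^ (n + 1) ≤ 1 := pow_le_one₀ (by norm_num) (by norm_num)
      linarith [first a b h0]

lemma codingFunction_mem_Icc (A : ℕ → Set X) (x : X) :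
    codingFunction A x ∈ Set.Icc (0 : ℝ) 1 := by
  have := cantorFunction_third_mem_Icc fun n => @decide (x ∈ A n) (Classical.propDecidable _)
  unfold codingFunction
  constructor <;> linarith [this.1, this.2]

lemma codingFunction_eq {A : ℕ → Set X} {x y : X} (hxy : ∀ n, x ∈ A n ↔ y ∈ A n) :
    codingFunction A x = codingFunction A y := by
  unfold codingFunction
  congr 2
  funext n
  exact decide_eq_decide.2 (hxy n)

lemma abs_indicator_sub_le_codingFunction (A : ℕ → Set X) (n : ℕ) (x y : X) :
    |(A n).indicator (fun _ => (1 : ℝ)) x - (A n).indicator (fun _ => (1 : ℝ)) y| ≤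
      3 * 3 ^ n * |codingFunction A x - codingFunction A y| := by
  classical
  by_cases hxy : x ∈ A n ↔ y ∈ A n
  · have : (A n).indicator (fun _ => (1 : ℝ)) x = (A n).indicator (fun _ => (1 : ℝ)) y := by
      simp only [Set.indicator_apply, hxy]
    rw [this, sub_self, abs_zero]
    positivity
  · have h1 := le_abs_cantorFunction_sub n (fun n => decide (x ∈ A n)) (fun n => decide (y ∈ A n))
      (by simpa using hxy)
    have h2 : |(A n).indicator (fun _ => (1 : ℝ)) x - (A n).indicator (fun _ => (1 : ℝ)) y| ≤ 1 :=
      abs_sub_le_one_of_mem_Icc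
        ⟨Set.indicator_nonneg (fun _ _ => zero_le_one) x,
          Set.indicator_le_self' (fun _ _ => zero_le_one) x⟩
        ⟨Set.indicator_nonneg (fun _ _ => zero_le_one) y,
          Set.indicator_le_self' (fun _ _ => zero_le_one) y⟩
    refine h2.trans ?_
    have h3 : codingFunction A x - codingFunction A y =
        2 / 3 * (Cardinal.cantorFunction (1 / 3) (fun n => decide (x ∈ A n)) -
          Cardinal.cantorFunction (1 / 3) (fun n => decide (y ∈ A n))) := by
      simp only [codingFunction, mul_sub]
    rw [h3, abs_mul, abs_of_pos (by norm_num : (0 : ℝ) < 2 / 3)]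
    have h4 : (3 : ℝ) ^ n * (1 / 3) ^ n = 1 := by rw [← mul_pow]; norm_num
    have h5 := mul_le_mul_of_nonneg_left h1 (by positivity : (0 : ℝ) ≤ 3 ^ n)
    linarith

lemma measurable_codingFunction [MeasurableSpace X] {A : ℕ → Set X}
    (hA : ∀ n, MeasurableSet (A n)) : Measurable (codingFunction A) := by
  classical
  refine Measurable.const_mul ?_ _
  refine measurable_of_tendsto_metrizable (f := fun (N : ℕ) (x : X) => ∑ n ∈ Finset.range N,
    (A n).indicator (fun _ => (1 / 3 : ℝ) ^ n) x)
    (fun N => Finset.measurable_sum _ fun n _ => measurable_const.indicator (hA n)) ?_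
  rw [tendsto_pi_nhds]
  intro x
  have h1 := (Cardinal.summable_cantor_function (c := 1 / 3)
    (fun n => @decide (x ∈ A n) (Classical.propDecidable _)) (by norm_num)
    (by norm_num)).hasSum.tendsto_sum_nat
  refine h1.congr fun N => Finset.sum_congr rfl fun n _ => ?_
  by_cases hx : x ∈ A n <;> simp [Cardinal.cantorFunctionAux, hx]

end CodingFunction

/-! ### Rigidity -/

section Conclusion

variable {X : Type*} {F : MeasurableSpace X} [mX : MeasurableSpace X] {μ : Measure X}
  {T : ℝ → X → X}

variable (F μ) in
/-- The measure algebra of a sub-σ-algebra is separable: to each member of a countable family dense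
among all measurable sets and each `1 / (m + 1)`, a set of the sub-σ-algebra within that distance of
it is assigned whenever there is one. -/
lemma exists_seq_dense_of_le [MeasurableSpace.CountablyGenerated X] [IsProbabilityMeasure μ] :
    ∃ A : ℕ → Set X, (∀ n, MeasurableSet[F] (A n)) ∧
      ∀ B, MeasurableSet[F] B → MeasurableSet B → ∀ ε > 0, ∃ n, μ.real (symmDiff B (A n)) ≤ ε := by
  classical
  obtain ⟨𝒜, h𝒜, hdense⟩ := exists_countable_measureDense μ
  obtain ⟨D, rfl⟩ := h𝒜.exists_eq_range hdense.nonempty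
  have hex : ∀ q : ℕ × ℕ, ∃ A, MeasurableSet[F] A ∧
      ((∃ A', MeasurableSet[F] A' ∧ μ.real (symmDiff A' (D q.1)) ≤ 1 / ((q.2 : ℝ) + 1)) →
        μ.real (symmDiff A (D q.1)) ≤ 1 / ((q.2 : ℝ) + 1)) := by
    intro q
    by_cases h : ∃ A', MeasurableSet[F] A' ∧ μ.real (symmDiff A' (D q.1)) ≤ 1 / ((q.2 : ℝ) + 1)
    · obtain ⟨A', h1, h2⟩ := h
      exact ⟨A', h1, fun _ => h2⟩
    · exact ⟨∅, @MeasurableSet.empty X F, fun h' => absurd h' h⟩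
  choose A hAF hA using hex
  refine ⟨fun n => A n.unpair, fun n => hAF _, fun B hB hBm ε hε => ?_⟩
  obtain ⟨m, hm⟩ := exists_nat_one_div_lt (half_pos hε)
  obtain ⟨_, ⟨i, rfl⟩, hi⟩ := hdense.approx B hBm (measure_ne_top _ _) (1 / ((m : ℝ) + 1))
    (by positivity)
  have h1 : μ.real (symmDiff B (D i)) ≤ 1 / ((m : ℝ) + 1) :=
    ENNReal.toReal_le_of_le_ofReal (by positivity) hi.le
  have h2 := hA (i, m) ⟨B, hB, h1⟩
  refine ⟨Nat.pair i m, ?_⟩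
  beta_reduce
  rw [Nat.unpair_pair]
  have h3 := measureReal_symmDiff_le (μ := μ) (s := B) (t := D i) (A (i, m))
  rw [symmDiff_comm (D i)] at h3
  exact h3.trans (by simp only at h2; linarith)

lemma abs_measureReal_inter_image_sub_le [IsProbabilityMeasure μ] (hT : IsFlow μ T) {A B : Set X}
    (hB : MeasurableSet B) (t : ℝ) :
    |μ.real (A ∩ T t '' B) - μ.real (A ∩ B)| ≤
      displacement μ T (B.indicator fun _ => (1 : ℝ)) t := by
  have hpre : T t '' B = T (-t) ⁻¹' B := by
    ext x
    constructor
    · rintro ⟨y, hy, rfl⟩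
      rwa [Set.mem_preimage, ← hT.map_add, neg_add_cancel, hT.map_zero]
    · exact fun hx => ⟨_, hx, hT.apply_neg_apply _ _⟩
  have mp := hT.measurePreserving (-t)
  have hi : Integrable (B.indicator fun _ => (1 : ℝ)) μ := (integrable_const _).indicator hB
  have hit : Integrable (fun x => B.indicator (fun _ => (1 : ℝ)) (T (-t) x)) μ :=
    mp.integrable_comp_of_integrable hi
  have e1 : μ.real (A ∩ T t '' B) = ∫ x in A, B.indicator (fun _ => (1 : ℝ)) (T (-t) x) ∂μ := by
    have : (fun x => B.indicator (fun _ => (1 : ℝ)) (T (-t) x)) =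
        (T (-t) ⁻¹' B).indicator fun _ => (1 : ℝ) := rfl
    rw [this, integral_indicator_const _ (mp.measurable hB),
      measureReal_restrict_apply (mp.measurable hB), smul_eq_mul, mul_one, hpre, Set.inter_comm]
  have e2 : μ.real (A ∩ B) = ∫ x in A, B.indicator (fun _ => (1 : ℝ)) x ∂μ := by
    rw [integral_indicator_const _ hB, measureReal_restrict_apply hB, smul_eq_mul, mul_one,
      Set.inter_comm]
  rw [e1, e2, ← integral_sub hit.integrableOn hi.integrableOn, ← displacement_neg hT hi t]
  exact (abs_integral_le_integral_abs).trans (setIntegral_le_integral (hit.sub hi).abs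
    (Eventually.of_forall fun _ => abs_nonneg _))

lemma displacement_indicator_le [IsProbabilityMeasure μ] (hT : IsFlow μ T) {A : ℕ → Set X}
    (hA : ∀ n, MeasurableSet (A n)) {B : Set X} (hB : MeasurableSet B) (n : ℕ) (t : ℝ) :
    displacement μ T (B.indicator fun _ => (1 : ℝ)) t ≤
      3 * 3 ^ n * displacement μ T (codingFunction A) t + 2 * μ.real (symmDiff B (A n)) := by
  have hiB : Integrable (B.indicator fun _ => (1 : ℝ)) μ := (integrable_const _).indicator hB
  have hiA : Integrable ((A n).indicator fun _ => (1 : ℝ)) μ :=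
    (integrable_const _).indicator (hA n)
  have mp := hT.measurePreserving t
  have hic : Integrable (codingFunction A) μ :=
    integrable_of_measurable_of_mem_Icc (measurable_codingFunction hA) (codingFunction_mem_Icc A)
  have h1 := integral_abs_sub_le_of_coupling mp (MeasurePreserving.id μ) hiB hiA
  have h2 : ∫ x, |B.indicator (fun _ => (1 : ℝ)) x - (A n).indicator (fun _ => (1 : ℝ)) x| ∂μ =
      μ.real (symmDiff B (A n)) := by
    have : (fun x => |B.indicator (fun _ => (1 : ℝ)) x - (A n).indicator (fun _ => (1 : ℝ)) x|) =
        (symmDiff B (A n)).indicator fun _ => (1 : ℝ) := by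
      ext x
      by_cases h1 : x ∈ B <;> by_cases h2 : x ∈ A n <;> simp [Set.mem_symmDiff, h1, h2]
    rw [this, integral_indicator_const _ (hB.symmDiff (hA n)), smul_eq_mul, mul_one]
  rw [h2] at h1
  refine h1.trans (add_le_add_left ?_ _)
  rw [displacement, ← integral_const_mul]
  exact integral_mono ((mp.integrable_comp_of_integrable hiA).sub hiA).abs
    (((mp.integrable_comp_of_integrable hic).sub hic).abs.const_mul _)
    fun x => abs_indicator_sub_le_codingFunction A n _ _

/-- Times that return `u` close to itself are replaced by multiples of the steps `s j`. -/
lemma exists_seq_tendsto_displacement [IsProbabilityMeasure μ] (hT : IsFlow μ T) {u : X → ℝ}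
    (hu : Integrable u μ) (hcont : Tendsto (displacement μ T u) (𝓝 0) (𝓝 0)) {s : ℕ → ℝ}
    (hs : ∀ j, 0 < s j) (hs0 : Tendsto s atTop (𝓝 0))
    (hrig : ∀ ε > 0, ∀ L : ℝ, ∃ t, L ≤ t ∧ displacement μ T u t < ε) :
    ∃ k : ℕ → ℤ, Tendsto (fun j => |(k j : ℝ) * s j|) atTop atTop ∧
      Tendsto (fun j => displacement μ T u ((k j : ℝ) * s j)) atTop (𝓝 0) := by
  -- The integer `k j` almost minimizes the cost, whose second term forces `k j * s j` to be large.
  set cost : ℕ → ℤ → ℝ := fun j k =>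
    displacement μ T u ((k : ℝ) * s j) + 1 / (1 + |(k : ℝ) * s j|) with hcost
  have hpos : ∀ j k, 0 ≤ cost j k := fun j k =>
    add_nonneg (displacement_nonneg _ _) (by positivity)
  have hsmall : ∀ ε > 0, ∀ᶠ j in atTop, ∃ k, cost j k < ε := by
    intro ε hε
    obtain ⟨t, ht, htε⟩ := hrig (ε / 3) (by positivity) (3 / ε + 1)
    obtain ⟨δ, hδ0, hδ⟩ := Metric.eventually_nhds_iff.1
      (hcont.eventually (gt_mem_nhds (show (0 : ℝ) < ε / 3 by positivity)))
    filter_upwards [hs0.eventually (gt_mem_nhds hδ0),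
      hs0.eventually (gt_mem_nhds (zero_lt_one' ℝ))] with j hj1 hj2
    refine ⟨⌊t / s j⌋, ?_⟩
    have h1 : (⌊t / s j⌋ : ℝ) * s j ≤ t := (le_div_iff₀ (hs j)).1 (Int.floor_le _)
    have h2 : t < (⌊t / s j⌋ : ℝ) * s j + s j := by
      have := (div_lt_iff₀ (hs j)).1 (Int.lt_floor_add_one (t / s j))
      linarith
    simp only [hcost]
    generalize (⌊t / s j⌋ : ℝ) = k at *
    have h3 := displacement_add_le hT hu t (k * s j - t)
    rw [add_sub_cancel] at h3
    have h4 : displacement μ T u (k * s j - t) < ε / 3 := hδ (by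
      rw [Real.dist_eq, sub_zero, abs_lt]
      constructor <;> linarith)
    have h5 : 1 / (1 + |k * s j|) < ε / 3 := by
      have h6 : 3 / ε < 1 + |k * s j| := by linarith [le_abs_self (k * s j)]
      rw [div_lt_iff₀ (by positivity)]
      rw [div_lt_iff₀ hε] at h6
      linarith
    linarith
  have hbdd : ∀ j, BddBelow (Set.range (cost j)) := fun j => ⟨0, by
    rintro _ ⟨k, rfl⟩; exact hpos j k⟩
  have hmin : ∀ j : ℕ, ∃ k, cost j k < (⨅ k, cost j k) + 1 / ((j : ℝ) + 1) := fun j =>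
    exists_lt_of_ciInf_lt (lt_add_of_pos_right _ (by positivity))
  choose k hk using hmin
  have hlim : Tendsto (fun j => cost j (k j)) atTop (𝓝 0) := by
    rw [Metric.tendsto_nhds]
    intro ε hε
    filter_upwards [hsmall (ε / 2) (by positivity),
      tendsto_one_div_add_atTop_nhds_zero_nat.eventually (gt_mem_nhds (half_pos hε))] with j h1 h2
    obtain ⟨k', hk'⟩ := h1
    rw [Real.dist_eq, sub_zero, abs_of_nonneg (hpos _ _)]
    linarith [hk j, ciInf_le (hbdd j) k']
  refine ⟨k, tendsto_atTop.2 fun M => ?_, squeeze_zero (fun _ => displacement_nonneg _ _)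
    (fun j => le_add_of_nonneg_right (by positivity)) hlim⟩
  filter_upwards [hlim.eventually (gt_mem_nhds (show (0 : ℝ) < 1 / (1 + |M|) by positivity))]
    with j hj
  have h1 : 1 / (1 + |(k j : ℝ) * s j|) < 1 / (1 + |M|) :=
    lt_of_le_of_lt (le_add_of_nonneg_left (displacement_nonneg _ _)) hj
  rw [one_div_lt_one_div (by positivity) (by positivity)] at h1
  linarith [le_abs_self M]

end Conclusion

/-- A Borel space is separated by a single function with values in the unit interval. -/
lemma exists_measurable_injective_mem_Icc (X : Type*) [MeasurableSpace X] [StandardBorelSpace X] :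
    ∃ g : X → ℝ, Measurable g ∧ Function.Injective g ∧ ∀ x, g x ∈ Set.Icc (0 : ℝ) 1 := by
  obtain ⟨e, he⟩ := exists_measurableEmbedding_real X
  refine ⟨fun x => Real.sigmoid (e x), ?_, ?_, fun x => ?_⟩
  · exact continuous_sigmoid.measurable.comp he.measurable
  · exact Real.sigmoid_injective.comp he.injective
  · exact ⟨Real.sigmoid_nonneg _, Real.sigmoid_le_one _⟩

theorem mainTheorem2 {X : Type*} (F : MeasurableSpace X) [mX : MeasurableSpace X]
    [StandardBorelSpace X] (μ : Measure X) [IsProbabilityMeasure μ] [NullSingletonClass μ]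
    (T : ℝ → X → X) (hT : IsFlow μ T)
    (s : ℕ → ℝ) (h : ℕ → ℕ) (E : ℕ → Set X) (hRank : IsRankOneData μ T s h E)
    (hF : IsFactor F T) (hF' : IsProperModNull F μ) :
    ∃ k : ℕ → ℤ,
      Tendsto (fun j => |(k j : ℝ) * s j|) atTop atTop ∧
      ∀ A B : Set X, MeasurableSet[F] A → MeasurableSet[F] B →
        Tendsto (fun j => μ (A ∩ T ((k j : ℝ) * s j) '' B)) atTop (𝓝 (μ (A ∩ B))) := by
  set p : ℕ → X → ℕ := fun j => towerPosition T (s j) (h j) (E j) with hp_def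
  have hp : ∀ j, IsTowerPosition T (s j) (h j) (p j) := fun j =>
    isTowerPosition_towerPosition hT (hRank.measurableSet_base j) (hRank.disjoint_levels j)
  have happrox : ApproximatesSets μ p := hRank.approximatesSets
  have hcover := happrox.tendsto_measureReal_compl fun j => (hp j).le
  obtain ⟨ν, hνp, hν, hνF, hνdiag⟩ := exists_selfJoining_of_isProperModNull hT hRank.height_pos hp
    hcover happrox hF hF'
  obtain ⟨A, hAF, hA⟩ := exists_seq_dense_of_le F μ
  have hAm : ∀ n, MeasurableSet (A n) := fun n => hF.le _ (hAF n)
  have hfm := measurable_codingFunction hAm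
  have hfi : Integrable (codingFunction A) μ :=
    integrable_of_measurable_of_mem_Icc hfm (codingFunction_mem_Icc A)
  have hfν : ∀ᵐ z ∂ν, codingFunction A z.1 = codingFunction A z.2 := by
    have h1 : ∀ᵐ z ∂ν, ∀ n, z ∉ A n ×ˢ (A n)ᶜ ∧ z ∉ (A n)ᶜ ×ˢ (A n)ᶜᶜ :=
      ae_all_iff.2 fun n => (measure_eq_zero_iff_ae_notMem.1 (hνF _ (hAF n))).and
        (measure_eq_zero_iff_ae_notMem.1 (hνF _ (hAF n).compl))
    filter_upwards [h1] with z hz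
    refine codingFunction_eq fun n => ?_
    have := hz n
    simp only [Set.mem_prod, Set.mem_compl_iff, not_not] at this
    tauto
  obtain ⟨g, hgm, hginj, hg01⟩ := exists_measurable_injective_mem_Icc X
  have hgν : ∀ᵐ z ∂ν, g z.1 ≠ g z.2 := by
    filter_upwards [measure_eq_zero_iff_ae_notMem.1 hνdiag] with z hz hgz
    exact hz (hginj hgz)
  have hgcont := tendsto_displacement_zero hT hgm (integrable_of_measurable_of_mem_Icc hgm hg01)
  obtain ⟨k, hk, hlim⟩ := exists_seq_tendsto_displacement hT hfi
    (tendsto_displacement_zero hT hfm hfi) hRank.step_pos hRank.step_tendsto fun ε hε L =>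
      exists_displacement_lt hT hRank.step_pos hRank.step_tendsto hRank.length_tendsto hp hcover
        (fun u hu hu01 η hη => happrox.eventually_exists_integral_le (fun j => (hp j).measurable)
          hu hu01 hη) hν hfm (codingFunction_mem_Icc A) hfν hgm hg01 hgν hgcont hε L
  refine ⟨k, hk, fun B C hB hC => ?_⟩
  rw [← ENNReal.tendsto_toReal_iff (fun _ => measure_ne_top _ _) (measure_ne_top _ _)]
  have hCm := hF.le _ hC
  rw [tendsto_iff_dist_tendsto_zero, Metric.tendsto_nhds]
  intro ε hε
  obtain ⟨n, hn⟩ := hA C hC hCm (ε / 8) (by positivity)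
  have h3 : (0 : ℝ) < 3 * 3 ^ n := by positivity
  filter_upwards [hlim.eventually (gt_mem_nhds (show 0 < ε / 2 / (3 * 3 ^ n) by positivity))]
    with j hj
  rw [lt_div_iff₀ h3] at hj
  rw [Real.dist_eq, sub_zero, Real.dist_eq, abs_abs]
  refine lt_of_le_of_lt (abs_measureReal_inter_image_sub_le hT hCm _) ?_
  have := displacement_indicator_le hT hAm hCm n ((k j : ℝ) * s j)
  linarith
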